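/- Let $k\ge 1$ and let there be $k$ coins; coin $i$ has an (unknown) probability $p_i\in[0,1]$ of heads, and all flips are independent. Let $C_1,\dots,C_k\ge 0$ be known with $C=C_1+\cdots+C_k>0$, put $r=C_1p_1+\cdots+C_kp_k$, and let $\epsilon>0$ be known with $r\le 1-\epsilon$. Consider the following procedures, in which every draw is independent of the previous ones, and only the flips of the $k$ coins are counted. For $\beta>0$ write $\beta\cdot(C_1,\dots,C_k)=(\beta C_1,\dots,\beta C_k)$. * Logistic_Bernoulli_Factory$(C_1,\dots,C_k)$: set $X\leftarrow 0$, draw $A\sim\mathrm{Exp}(1)$ and $T\sim\mathrm{Exp}(C)$, where $C=\sum_j C_j$ and the parameter is the rate. While $X=0$ and $T<A$: choose $I$ with $\mathbb P(I=i)=C_i/C$, flip coin $I$; if it is heads set $X\leftarrow 1$, otherwise add to $T$ a draw from $\mathrm{Exp}(C)$. Return $X$. * A$(m,(C_1,\dots,C_k))$: set $I\leftarrow 1$. While $I\notin\{0,m\}$: draw $B\leftarrow$ Logistic_Bernoulli_Factory$(C_1,\dots,C_k)$ and set $I\leftarrow I+1-2B$. Return $1$ if $I=0$, and $0$ otherwise.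 * High_Power_Logistic_BF$(m,\beta,(C_1,\dots,C_k))$: set $s\leftarrow 1$. While $s\in\{1,\dots,m\}$: draw $B\leftarrow$ Logistic_Bernoulli_Factory$(\beta\cdot(C_1,\dots,C_k))$ and set $s\leftarrow s+B-(1-B)$. Return $1$ if $s=m+1$, and $0$ otherwise. * B$(\epsilon,m,\beta,(C_1,\dots,C_k))$: repeat the following until a value is returned. Draw $B_1\leftarrow$ Linear_Bernoulli_Factory$(1-(1-\epsilon)\beta,\ \beta\cdot(C_1,\dots,C_k))$. If $B_1=0$, return $0$. Otherwise draw $B_2\leftarrow$ High_Power_Logistic_BF$(m-2,\beta,(C_1,\dots,C_k))$; if $B_2=1$, return $1$, otherwise set $m\leftarrow m-1$ (with $\beta$ unchanged). * Linear_Bernoulli_Factory$(\epsilon,(C_1,\dots,C_k))$: set $m\leftarrow\lceil 4.5\,\epsilon^{-1}\rceil+1$ and $\beta\leftarrow 1+1/(m-1)$. Draw $B_1\leftarrow$ A$(m,\beta\cdot(C_1,\dots,C_k))$. If $B_1=0$, return $0$. Otherwise draw $B_2\sim\mathrm{Bern}(1/\beta)$; if $B_2=1$, return $1$, otherwise return the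 result of B$(\epsilon,m,\beta,(C_1,\dots,C_k))$. Then Linear_Bernoulli_Factory$(\epsilon,(C_1,\dots,C_k))$ halts with probability one, its output $B$ is a Bernoulli variable with mean $r$, and the expected total number of coin flips that it uses, all recursive calls included, is at most $$7.57\,C\,\epsilon^{-1}.$$ -/

import Mathlib

open scoped ENNReal

namespace BernoulliFactory

noncomputable section

/-- The semantics of a randomised procedure that returns a value in `α` and flips coins.
A run is represented by its expectation functional: for `f : α → ℕ → [0, ∞]`,
`R f` is the expectation of `f (returned value) (number of coin flips used)` over the event that
the run halts (a run that does not halt contributes `0`).  Thus the law of the pair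
(returned value, number of flips) is obtained by applying `R` to indicator functions. -/
def Run (α : Type) : Type := (α → ℕ → ℝ≥0∞) → ℝ≥0∞

/-- Sequential composition: the second procedure gets the value returned by the first one and
fresh independent randomness, and the numbers of flips add up. -/
instance : Monad Run where
  pure a := fun f => f a 0
  bind R S := fun f => R fun a n => S a fun b n' => f b (n + n')

/-- A procedure that never halts. -/
def diverge {α : Type} : Run α := fun _ => 0

/-- A run is the limit of its approximations, here: cut off at `0, 1, 2, …` units of fuel. -/
def limitRun {α : Type} (R : ℕ → Run α) : Run α := fun f => ⨆ n, R n f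

/-- One flip of the `i`-th coin, which has probability `p i` of heads.
This is the only instruction that uses coins; it costs one flip. -/
def flipCoin {k : ℕ} (p : Fin k → ℝ) (i : Fin k) : Run Bool := fun f =>
  ENNReal.ofReal (p i) * f true 1 + ENNReal.ofReal (1 - p i) * f false 1

/-- Auxiliary randomness: a Bernoulli variable with known mean `q`. -/
def drawBern (q : ℝ) : Run Bool := fun f =>
  ENNReal.ofReal q * f true 0 + ENNReal.ofReal (1 - q) * f false 0

/-- Auxiliary randomness: an exponential variable of rate `lam`. -/
def drawExp (lam : ℝ) : Run ℝ := fun f =>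
  ∫⁻ t, f t 0 ∂(ProbabilityTheory.expMeasure lam)

/-- Auxiliary randomness: an index `i` with probability `c i / (c 1 + ⋯ + c k)`. -/
def drawIndex {k : ℕ} (c : Fin k → ℝ) : Run (Fin k) := fun f =>
  ∑ i, ENNReal.ofReal (c i / ∑ j, c j) * f i 0

open Classical in
/-- The while loop restricted to runs that leave it after fewer than `fuel` rounds. -/
def whileFuel {σ : Type} (cond : σ → Prop) (body : σ → Run σ) : ℕ → σ → Run σ
  | 0, _ => diverge
  | fuel + 1, s => if cond s then body s >>= whileFuel cond body fuel else pure s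

/-- `while cond do body`, started in state `s`; returns the final state. -/
def whileLoop {σ : Type} (cond : σ → Prop) (body : σ → Run σ) (s : σ) : Run σ :=
  limitRun fun fuel => whileFuel cond body fuel s

/-- `Logistic_Bernoulli_Factory`; the loop state is the pair `(X, T)`. -/
def logisticBF {k : ℕ} (p c : Fin k → ℝ) : Run Bool := do
  let A ← drawExp 1
  let T₀ ← drawExp (∑ j, c j)
  let s ← whileLoop (fun s : Bool × ℝ => s.1 = false ∧ s.2 < A)
    (fun s => do
      let i ← drawIndex c
      let B ← flipCoin p i
      if B then
        pure (true, s.2)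
      else do
        let e ← drawExp (∑ j, c j)
        pure (false, s.2 + e))
    (false, T₀)
  pure s.1

/-- Algorithm `A`; the loop state is `I`. -/
def algA {k : ℕ} (p : Fin k → ℝ) (m : ℤ) (c : Fin k → ℝ) : Run Bool := do
  let I ← whileLoop (fun I : ℤ => I ≠ 0 ∧ I ≠ m)
    (fun I => do
      let B ← logisticBF p c
      pure (I + 1 - 2 * (if B then 1 else 0)))
    1
  pure (decide (I = 0))

/-- `High_Power_Logistic_BF`; the loop state is `s`. -/
def highPowerLogisticBF {k : ℕ} (p : Fin k → ℝ) (m : ℤ) (β : ℝ) (c : Fin k → ℝ) :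
    Run Bool := do
  let s ← whileLoop (fun s : ℤ => 1 ≤ s ∧ s ≤ m)
    (fun s => do
      let B ← logisticBF p (fun i => β * c i)
      pure (if B then s + 1 else s - 1))
    1
  pure (decide (s = m + 1))

/-- Algorithm `B`, with the procedure `lin` in the place of the recursive calls to
`Linear_Bernoulli_Factory`.  The loop state is `(X, m)`, where `X = none` stands for the
undecided initial value of the output. -/
def algB {k : ℕ} (lin : ℝ → (Fin k → ℝ) → Run Bool) (p : Fin k → ℝ)
    (ε : ℝ) (m : ℤ) (β : ℝ) (c : Fin k → ℝ) : Run Bool := do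
  let s ← whileLoop (fun s : Option Bool × ℤ => s.1 = none)
    (fun s => do
      let B₁ ← lin (1 - (1 - ε) * β) (fun i => β * c i)
      if B₁ then do
        let B₂ ← highPowerLogisticBF p (s.2 - 2) β c
        if B₂ then
          pure (some true, s.2)
        else
          pure (none, s.2 - 1)
      else
        pure (some false, s.2))
    (none, m)
  pure (s.1.getD false)

/-- `Linear_Bernoulli_Factory`, restricted to runs whose recursion depth is less than `fuel`. -/
def linearBFFuel {k : ℕ} (p : Fin k → ℝ) : ℕ → ℝ → (Fin k → ℝ) → Run Bool
  | 0, _, _ => diverge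
  | fuel + 1, ε, c => do
    let m : ℤ := ⌈4.5 * ε⁻¹⌉ + 1
    let β : ℝ := 1 + 1 / ((m : ℝ) - 1)
    let B₁ ← algA p m (fun i => β * c i)
    if B₁ then do
      let B₂ ← drawBern (1 / β)
      if B₂ then
        pure true
      else
        algB (linearBFFuel p fuel) p ε m β c
    else
      pure false

/-- `Linear_Bernoulli_Factory` with inputs `ε` and `c = (C₁, …, C_k)`, run on coins with
probabilities of heads `p = (p₁, …, p_k)`. -/
def linearBF {k : ℕ} (p : Fin k → ℝ) (ε : ℝ) (c : Fin k → ℝ) : Run Bool :=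
  limitRun fun fuel => linearBFFuel p fuel ε c

/-- The probability that the run halts and returns `b`. -/
def probOutput (R : Run Bool) (b : Bool) : ℝ≥0∞ := R fun a _ => if a = b then 1 else 0

/-- The expected number of coin flips (over the event that the run halts; for a run that halts
almost surely this is the expected number of flips). -/
def expectedFlips (R : Run Bool) : ℝ≥0∞ := R fun _ n => (n : ℝ≥0∞)

end

end BernoulliFactory

/-!
All four procedures are analysed through their expectation functionals.  Each of them is linear,
monotone and of mass at most `1` (`IsLaw`), so that output probabilities and expected numbers of
flips compose, and each loop is controlled by potentials: a superharmonic function bounds an exit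
probability from above (`whileLoop_le`), a function that drops by the expected cost of a round
bounds the expected number of flips (`whileLoop_flips_le`), and a finite function that drops by `1`
in each round forces termination (`whileLoop_mass`).  Only upper bounds for the probabilities of
the two outputs are needed: if they add up to `1` and the procedure halts almost surely, they are
equalities.

The logistic factory is a race between `A` and a Poisson clock of rate `C`.  By the lack of memory
of `A` (`lintegral_race`) a round ends the loop before a flip, with heads, or with tails, with
probabilities `1 / (1 + C)`, `r / (1 + C)`, `(C - r) / (1 + C)`, independently of the past.  Hence
the output is `1` with probability `r / (1 + r)`, at an expected cost of `C / (1 + r)` flips.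

Put `ρ = β r`.  Algorithm `A` and the high power factory are gambler's ruin walks with odds `ρ : 1`,
whose exit probabilities are combinations of `1` and `ρ ^ n`.  Algorithm `B` started with
`m = j + 2` has mean `(j + 1) ρ ^ (j + 1) / (1 + ρ + ⋯ + ρ ^ j)` (`algBMean`), which is what is
needed to turn the mean of algorithm `A`, after the thinning by `1 / β`, into `r` (`linear_mean`).

Since the recursive calls only need to have correct means, everything is proved by induction on the
recursion depth (`linearBounds`).  Algorithm `B` is entered with probability at most
`1 - 1 / β = 1 / m` and makes at most `1 / (1 - ρ)` recursive calls on average, where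
`m (1 - ρ) ≥ 7 / 2`.  So the probability of exceeding the depth `n` is at most `(2 / 7) ^ n`, and
the bound on the flips reproduces itself by an elementary inequality (`flips_inequality`).
-/

namespace BernoulliFactory

/-! ### Runs given by a law -/

/-- A run is a law if its expectation functional is monotone and linear and has total mass at
most `1`.  Only finite additivity is needed, so no measurability enters. -/
structure IsLaw {α : Type} (R : Run α) : Prop where
  mono : ∀ f g : α → ℕ → ℝ≥0∞, (∀ a n, f a n ≤ g a n) → R f ≤ R g
  add : ∀ f g : α → ℕ → ℝ≥0∞, R (fun a n => f a n + g a n) = R f + R g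
  smul : ∀ (x : ℝ≥0∞) (f : α → ℕ → ℝ≥0∞), R (fun a n => x * f a n) = x * R f
  mass_le : R (fun _ _ => 1) ≤ 1

theorem bind_apply {α β : Type} (R : Run α) (S : α → Run β) (f : β → ℕ → ℝ≥0∞) :
    (R >>= S) f = R fun a n => S a fun b n' => f b (n + n') := rfl

theorem pure_apply {α : Type} (a : α) (f : α → ℕ → ℝ≥0∞) : (pure a : Run α) f = f a 0 := rfl

namespace IsLaw

variable {α β : Type}

theorem pure (a : α) : IsLaw (Pure.pure a : Run α) :=
  ⟨fun _ _ h => h a 0, fun _ _ => rfl, fun _ _ => rfl, le_refl _⟩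

theorem bind {R : Run α} {S : α → Run β} (hR : IsLaw R) (hS : ∀ a, IsLaw (S a)) :
    IsLaw (R >>= S) where
  mono f g h := hR.mono _ _ fun a n => (hS a).mono _ _ fun b n' => h b (n + n')
  add f g := by
    simp only [bind_apply, (hS _).add, hR.add]
  smul x f := by
    simp only [bind_apply, (hS _).smul, hR.smul]
  mass_le := (hR.mono _ _ fun a _ => (hS a).mass_le).trans hR.mass_le

theorem diverge : IsLaw (diverge : Run α) :=
  ⟨fun _ _ _ => le_refl _, fun _ _ => (add_zero _).symm, fun _ _ => (mul_zero _).symm, zero_le_one⟩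

theorem limitRun {R : ℕ → Run α} (hR : ∀ n, IsLaw (R n)) (hmono : ∀ f, Monotone fun n => R n f) :
    IsLaw (limitRun R) where
  mono f g h := iSup_mono fun n => (hR n).mono f g h
  add f g := by
    simp only [BernoulliFactory.limitRun, (hR _).add]
    exact (ENNReal.iSup_add_iSup_of_monotone (hmono f) (hmono g)).symm
  smul x f := by
    simp only [BernoulliFactory.limitRun, (hR _).smul, ENNReal.mul_iSup]
  mass_le := iSup_le fun n => (hR n).mass_le

theorem drawBern {q : ℝ} (h0 : 0 ≤ q) (h1 : q ≤ 1) : IsLaw (drawBern q) where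
  mono f g h := by
    unfold BernoulliFactory.drawBern
    gcongr <;> apply h
  add f g := by
    unfold BernoulliFactory.drawBern
    ring
  smul x f := by
    unfold BernoulliFactory.drawBern
    ring
  mass_le := by
    unfold BernoulliFactory.drawBern
    rw [mul_one, mul_one, ← ENNReal.ofReal_add h0 (by linarith)]
    simp

theorem ite {P : Prop} [Decidable P] {R S : Run α} (hR : P → IsLaw R) (hS : ¬ P → IsLaw S) :
    IsLaw (if P then R else S) := by
  split_ifs with h
  exacts [hR h, hS h]

theorem apply_bool {R : Run Bool} (hR : IsLaw R) (g : Bool → ℝ≥0∞) :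
    R (fun b _ => g b) = probOutput R true * g true + probOutput R false * g false := by
  have : (fun (b : Bool) (_ : ℕ) => g b) = fun b _ =>
      g true * (if b = true then 1 else 0) + g false * (if b = false then 1 else 0) := by
    funext b _
    cases b <;> simp
  rw [this, hR.add, hR.smul, hR.smul, mul_comm, mul_comm (g false)]
  rfl

theorem mass_bool {R : Run Bool} (hR : IsLaw R) :
    R (fun _ _ => 1) = probOutput R true + probOutput R false := by
  simpa using hR.apply_bool fun _ => 1

/-- Starting with `n` flips already made adds at most `n` to the expected number of flips. -/
theorem shifted_flips_le {R : Run α} (hR : IsLaw R) (n : ℕ) :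
    R (fun _ n' => ((n + n' : ℕ) : ℝ≥0∞)) ≤ n + R fun _ n' => (n' : ℝ≥0∞) := by
  have h := hR.smul n fun _ _ => 1
  simp only [Nat.cast_add]
  rw [hR.add fun _ _ => (n : ℝ≥0∞)]
  simp only [mul_one] at h
  rw [h]
  gcongr
  exact mul_le_of_le_one_right (zero_le) hR.mass_le

end IsLaw

theorem probOutput_bind {R : Run Bool} (hR : IsLaw R) (S : Bool → Run Bool) (b : Bool) :
    probOutput (R >>= S) b =
      probOutput R true * probOutput (S true) b + probOutput R false * probOutput (S false) b :=
  hR.apply_bool fun a => probOutput (S a) b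

theorem probOutput_pure (a b : Bool) :
    probOutput (pure a : Run Bool) b = if a = b then 1 else 0 := rfl

/-- The expected numbers of flips of two successive procedures add up; there is only an inequality,
as the flips of the first count only if the second one halts. -/
theorem flips_bind_le {β : Type} {R : Run Bool} (hR : IsLaw R) {S : Bool → Run β}
    (hS : ∀ b, IsLaw (S b)) :
    (R >>= S) (fun _ n => (n : ℝ≥0∞)) ≤ expectedFlips R
      + (probOutput R true * S true (fun _ n => (n : ℝ≥0∞))
        + probOutput R false * S false (fun _ n => (n : ℝ≥0∞))) := by
  rw [← hR.apply_bool fun b => S b fun _ n => (n : ℝ≥0∞)]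
  refine le_trans ?_ (hR.add (fun _ n => (n : ℝ≥0∞)) fun b _ => S b fun _ n => (n : ℝ≥0∞)).le
  exact hR.mono _ _ fun a n => (hS a).shifted_flips_le n

theorem probOutput_drawBern (q : ℝ) (b : Bool) :
    probOutput (drawBern q) b = ENNReal.ofReal (if b then q else 1 - q) := by
  cases b <;> simp [probOutput, drawBern]

theorem expectedFlips_drawBern (q : ℝ) : expectedFlips (drawBern q) = 0 := by
  simp [expectedFlips, drawBern]

/-! ### While loops -/

section Loop

variable {σ : Type} {cond : σ → Prop} {body : σ → Run σ}

theorem whileFuel_succ_of_pos {s : σ} (hs : cond s) (n : ℕ) :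
    whileFuel cond body (n + 1) s = body s >>= whileFuel cond body n := by
  simp [whileFuel, hs]

theorem whileFuel_succ_of_neg {s : σ} (hs : ¬ cond s) (n : ℕ) :
    whileFuel cond body (n + 1) s = pure s := by
  simp [whileFuel, hs]

theorem whileFuel_isLaw (hb : ∀ s, cond s → IsLaw (body s)) (n : ℕ) (s : σ) :
    IsLaw (whileFuel cond body n s) := by
  induction n generalizing s with
  | zero => exact IsLaw.diverge
  | succ n ih =>
    by_cases hs : cond s
    · rw [whileFuel_succ_of_pos hs]
      exact (hb s hs).bind ih
    · rw [whileFuel_succ_of_neg hs]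
      exact IsLaw.pure s

theorem whileFuel_mono
    (hb : ∀ s, cond s → ∀ f g : σ → ℕ → ℝ≥0∞, (∀ a n, f a n ≤ g a n) → body s f ≤ body s g)
    (s : σ) (f : σ → ℕ → ℝ≥0∞) :
    Monotone fun n => whileFuel cond body n s f := by
  refine monotone_nat_of_le_succ fun n => ?_
  induction n generalizing s f with
  | zero => exact zero_le
  | succ n ih =>
    by_cases hs : cond s
    · rw [whileFuel_succ_of_pos hs, whileFuel_succ_of_pos hs]
      exact hb s hs _ _ fun a k => ih _ _
    · rw [whileFuel_succ_of_neg hs, whileFuel_succ_of_neg hs]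

theorem whileLoop_isLaw (hb : ∀ s, cond s → IsLaw (body s)) (s : σ) :
    IsLaw (whileLoop cond body s) :=
  IsLaw.limitRun (whileFuel_isLaw hb · s) (whileFuel_mono (fun s hs => (hb s hs).mono) s)

/-- A function which dominates `g` at the exits and does not increase on average along the loop
bounds the expectation of `g` at the exit. -/
theorem whileLoop_le (hb : ∀ s, cond s → IsLaw (body s)) {g Φ : σ → ℝ≥0∞}
    (hexit : ∀ s, ¬ cond s → g s ≤ Φ s)
    (hstep : ∀ s, cond s → body s (fun s' _ => Φ s') ≤ Φ s) (s : σ) :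
    whileLoop cond body s (fun s' _ => g s') ≤ Φ s := by
  refine iSup_le fun n => ?_
  beta_reduce
  induction n generalizing s with
  | zero => exact zero_le
  | succ n ih =>
    by_cases hs : cond s
    · rw [whileFuel_succ_of_pos hs]
      exact ((hb s hs).mono _ _ fun a k => ih a).trans (hstep s hs)
    · rw [whileFuel_succ_of_neg hs]
      exact hexit s hs

/-- A potential which drops on average by at least the expected number of flips of one round
bounds the expected number of flips of the loop. -/
theorem whileLoop_flips_le (hb : ∀ s, cond s → IsLaw (body s)) {V : σ → ℝ≥0∞}
    (hstep : ∀ s, cond s →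
      body s (fun _ n => (n : ℝ≥0∞)) + body s (fun s' _ => V s') ≤ V s) (s : σ) :
    whileLoop cond body s (fun _ n => (n : ℝ≥0∞)) ≤ V s := by
  refine iSup_le fun n => ?_
  beta_reduce
  induction n generalizing s with
  | zero => exact zero_le
  | succ n ih =>
    by_cases hs : cond s
    · rw [whileFuel_succ_of_pos hs]
      refine le_trans ?_ (hstep s hs)
      rw [← (hb s hs).add]
      refine (hb s hs).mono _ _ fun a k => ?_
      exact ((whileFuel_isLaw hb n a).shifted_flips_le k).trans (by gcongr; exact ih a)
    · rw [whileFuel_succ_of_neg hs]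
      simp [pure_apply]

/-- A loop whose body halts almost surely halts almost surely itself if some potential, finite at
the initial state, drops on average by at least `1` in each round. -/
theorem whileLoop_mass (hb : ∀ s, cond s → IsLaw (body s))
    (hmass : ∀ s, cond s → body s (fun _ _ => 1) = 1) {V : σ → ℝ≥0∞}
    (hstep : ∀ s, cond s → 1 + body s (fun s' _ => V s') ≤ V s) (s : σ) (hV : V s ≠ ⊤) :
    whileLoop cond body s (fun _ _ => 1) = 1 := by
  -- The probability of more than `n` rounds is at most `V s / n`.
  have key : ∀ (n : ℕ) (s : σ),
      (n : ℝ≥0∞) ≤ n * whileFuel cond body n s (fun _ _ => 1) + V s := by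
    intro n
    induction n with
    | zero => simp
    | succ n ih =>
      intro s
      by_cases hs : cond s
      · rw [whileFuel_succ_of_pos hs, bind_apply]
        set u : σ → ℝ≥0∞ := fun a => whileFuel cond body n a fun _ _ => 1
        have h := (hb s hs).mono (fun _ _ => n * 1) (fun a _ => n * u a + V a) fun a _ => by
          simpa using ih a
        rw [(hb s hs).smul, hmass s hs, (hb s hs).add, (hb s hs).smul, mul_one] at h
        calc ((n + 1 : ℕ) : ℝ≥0∞) = n + 1 := by push_cast; rfl
          _ ≤ n * body s (fun a _ => u a) + body s (fun a _ => V a) + 1 := by gcongr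
          _ = n * body s (fun a _ => u a) + (1 + body s (fun a _ => V a)) := by ring
          _ ≤ (n + 1 : ℕ) * body s (fun a _ => u a) + V s := by
            gcongr
            · exact Nat.le_succ n
            · exact hstep s hs
      · rw [whileFuel_succ_of_neg hs, pure_apply, mul_one]
        exact le_self_add
  have hlaw := whileLoop_isLaw hb s
  refine le_antisymm hlaw.mass_le ?_
  set U := whileLoop cond body s fun _ _ => 1 with hU
  have hU1 : U ≤ 1 := hlaw.mass_le
  have hUtop : U ≠ ⊤ := ne_top_of_le_ne_top ENNReal.one_ne_top hU1
  have key' : ∀ n : ℕ, (n : ℝ) ≤ n * U.toReal + (V s).toReal := by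
    intro n
    have : (n : ℝ≥0∞) ≤ n * U + V s := (key n s).trans (by
      gcongr
      exact le_iSup (fun n => whileFuel cond body n s fun _ _ => 1) n)
    have := ENNReal.toReal_mono (by finiteness) this
    rwa [ENNReal.toReal_add (by finiteness) hV, ENNReal.toReal_mul, ENNReal.toReal_natCast] at this
  by_contra hlt
  have hlt : U.toReal < 1 := by
    rw [← ENNReal.toReal_one]
    exact (ENNReal.toReal_lt_toReal hUtop ENNReal.one_ne_top).2 (not_le.1 hlt)
  obtain ⟨n, hn⟩ := exists_nat_gt ((V s).toReal / (1 - U.toReal))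
  rw [div_lt_iff₀ (by linarith)] at hn
  linarith [key' n]

end Loop

/-! ### The race between two exponential variables -/

section Race

open MeasureTheory ProbabilityTheory

theorem lintegral_expMeasure (r : ℝ) {g : ℝ → ℝ≥0∞} (hg : Measurable g) :
    ∫⁻ x, g x ∂(expMeasure r) = ∫⁻ x, exponentialPDF r x * g x :=
  lintegral_withDensity_eq_lintegral_mul _ (measurable_exponentialPDFReal r).ennreal_ofReal hg

/-- The exponential variable of rate `1` has no memory. -/
theorem lintegral_expMeasure_one_excess {t : ℝ} (ht : 0 ≤ t) {h : ℝ → ℝ≥0∞} (hh : Measurable h) :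
    ∫⁻ x, (if t < x then h (x - t) else 0) ∂(expMeasure 1)
      = ENNReal.ofReal (Real.exp (-t)) * ∫⁻ x, h x ∂(expMeasure 1) := by
  have hm : Measurable fun x : ℝ => if t < x then h (x - t) else 0 :=
    Measurable.ite measurableSet_Ioi (by fun_prop) measurable_const
  rw [lintegral_expMeasure 1 hm, lintegral_expMeasure 1 hh,
    ← lintegral_const_mul' _ _ ENNReal.ofReal_ne_top, ← lintegral_add_right_eq_self _ t]
  refine lintegral_congr_ae ?_
  have h0 : ∀ᵐ x : ℝ, x ≠ 0 := by simp [ae_iff]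
  filter_upwards [h0] with x hx
  rcases lt_or_gt_of_ne hx with hx | hx
  · simp [exponentialPDF_of_neg hx, not_lt.2 hx.le]
  · rw [exponentialPDF_of_nonneg (by linarith), exponentialPDF_of_nonneg hx.le,
      if_pos (by linarith), ← mul_assoc, ← ENNReal.ofReal_mul (Real.exp_pos _).le,
      add_sub_cancel_right]
    congr 2
    rw [one_mul, one_mul, one_mul, one_mul, ← Real.exp_add]
    ring_nf

theorem expMeasure_ae_nonneg (r : ℝ) : ∀ᵐ t ∂(expMeasure r), 0 ≤ t := by
  have hm : Measurable fun x : ℝ => if 0 ≤ x then (0 : ℝ≥0∞) else 1 :=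
    Measurable.ite measurableSet_Ici measurable_const measurable_const
  have h : ∫⁻ x, (if 0 ≤ x then (0 : ℝ≥0∞) else 1) ∂(expMeasure r) = 0 := by
    rw [lintegral_expMeasure r hm, ← lintegral_zero]
    congr 1
    funext x
    split_ifs with hx
    · simp
    · simp [exponentialPDF_of_neg (not_le.1 hx)]
  rw [lintegral_eq_zero_iff hm] at h
  filter_upwards [h] with x hx
  by_contra hn
  simp [hn] at hx

theorem lintegral_exp_neg_expMeasure {r : ℝ} (hr : 0 < r) :
    ∫⁻ t, ENNReal.ofReal (Real.exp (-t)) ∂(expMeasure r) = ENNReal.ofReal (r / (1 + r)) := by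
  rw [lintegral_expMeasure r (by fun_prop)]
  have h : ∀ x, exponentialPDF r x * ENNReal.ofReal (Real.exp (-x))
      = ENNReal.ofReal (r / (1 + r)) * exponentialPDF (1 + r) x := by
    intro x
    rcases lt_or_ge x 0 with hx | hx
    · simp [exponentialPDF_of_neg hx]
    · rw [exponentialPDF_of_nonneg hx, exponentialPDF_of_nonneg hx,
        ← ENNReal.ofReal_mul (by positivity), ← ENNReal.ofReal_mul (by positivity)]
      congr 1
      rw [mul_assoc, ← Real.exp_add, ← mul_assoc, div_mul_cancel₀ _ (by positivity)]
      ring_nf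
  simp only [h]
  rw [lintegral_const_mul' _ _ ENNReal.ofReal_ne_top,
    lintegral_exponentialPDF_eq_one (by positivity), mul_one]

/-- If the clock `T` rings before `A`, which has probability `r / (1 + r)`, the remaining time
`A - T` is distributed as `A`. -/
theorem lintegral_race {r : ℝ} (hr : 0 < r) {h : ℝ → ℝ≥0∞} (hh : Measurable h) :
    ∫⁻ A, ∫⁻ T, (if 0 < A - T then h (A - T) else 0) ∂(expMeasure r) ∂(expMeasure 1)
      = ENNReal.ofReal (r / (1 + r)) * ∫⁻ x, h x ∂(expMeasure 1) := by
  have := isProbabilityMeasure_expMeasure hr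
  have := isProbabilityMeasure_expMeasure one_pos
  rw [lintegral_lintegral_swap]
  · rw [← lintegral_exp_neg_expMeasure hr, ← lintegral_mul_const _ (by fun_prop)]
    refine lintegral_congr_ae ?_
    filter_upwards [expMeasure_ae_nonneg r] with t ht
    simp only [sub_pos]
    exact lintegral_expMeasure_one_excess ht hh
  · refine Measurable.aemeasurable ?_
    exact Measurable.ite (measurableSet_lt measurable_const (by fun_prop)) (by fun_prop)
      measurable_const

/-- The expectation of a constant on the event that `A` comes first. -/
theorem lintegral_race_lost {r : ℝ} (hr : 0 < r) (x : ℝ≥0∞) :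
    ∫⁻ A, ∫⁻ T, (if 0 < A - T then 0 else x) ∂(expMeasure r) ∂(expMeasure 1)
      = ENNReal.ofReal (1 / (1 + r)) * x := by
  have := isProbabilityMeasure_expMeasure hr
  have := isProbabilityMeasure_expMeasure one_pos
  have hm : Measurable fun z : ℝ × ℝ => if 0 < z.1 - z.2 then (0 : ℝ≥0∞) else 1 :=
    Measurable.ite (measurableSet_lt measurable_const (by fun_prop)) measurable_const
      measurable_const
  have hm' : ∀ A : ℝ, Measurable fun T : ℝ => if 0 < A - T then (0 : ℝ≥0∞) else 1 :=
    fun A => hm.comp measurable_prodMk_left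
  have hx : ∀ A T : ℝ, (if 0 < A - T then 0 else x)
      = (if 0 < A - T then (0 : ℝ≥0∞) else 1) * x := by
    intro A T
    split_ifs <;> simp
  simp only [hx]
  simp only [lintegral_mul_const _ (hm' _)]
  rw [lintegral_mul_const _ hm.lintegral_prod_right']
  congr 1
  -- The two orders of `A` and `T` have total probability `1`.
  have h1 : ∫⁻ A, ∫⁻ T, ((if 0 < A - T then (0 : ℝ≥0∞) else 1) + (if 0 < A - T then 1 else 0))
      ∂(expMeasure r) ∂(expMeasure 1) = 1 := by
    have : ∀ A T : ℝ, (if 0 < A - T then (0 : ℝ≥0∞) else 1) + (if 0 < A - T then 1 else 0) = 1 := by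
      intro A T
      split_ifs <;> simp
    simp only [this, lintegral_one, measure_univ]
  simp only [lintegral_add_left (hm' _)] at h1
  rw [lintegral_add_left hm.lintegral_prod_right', lintegral_race hr measurable_const] at h1
  simp only [lintegral_one, measure_univ, mul_one] at h1
  rw [← ENNReal.add_left_inj (a := ENNReal.ofReal (r / (1 + r))) ENNReal.ofReal_ne_top, h1,
    ← ENNReal.ofReal_add (by positivity) (by positivity), ← add_div, div_self (by positivity),
    ENNReal.ofReal_one]

end Race

/-! ### The logistic Bernoulli factory -/

section Logistic

open MeasureTheory ProbabilityTheory

variable {k : ℕ}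

/-- The loop body of `logisticBF`, written out as an expectation functional. -/
noncomputable def logisticBody (p c : Fin k → ℝ) (s : Bool × ℝ) : Run (Bool × ℝ) := fun f =>
  ∑ i, ENNReal.ofReal (c i / ∑ j, c j) *
    (ENNReal.ofReal (p i) * f (true, s.2) 1 +
      ENNReal.ofReal (1 - p i) * ∫⁻ e, f (false, s.2 + e) 1 ∂(expMeasure (∑ j, c j)))

theorem logisticBF_eq_lintegral (p c : Fin k → ℝ) (f : Bool → ℕ → ℝ≥0∞) :
    logisticBF p c f = ∫⁻ A, ∫⁻ T,
      ⨆ n, whileFuel (fun s : Bool × ℝ => s.1 = false ∧ s.2 < A) (logisticBody p c) n (false, T)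
        (fun s m => f s.1 m) ∂(expMeasure (∑ j, c j)) ∂(expMeasure 1) := by
  have hb : logisticBody p c = (fun s => do
      let i ← drawIndex c
      let B ← flipCoin p i
      if B then
        pure (true, s.2)
      else do
        let e ← drawExp (∑ j, c j)
        pure (false, s.2 + e)) := by
    funext s f
    simp [logisticBody, bind_apply, drawIndex, flipCoin, drawExp, pure_apply]
  rw [hb]
  simp [logisticBF, bind_apply, whileLoop, limitRun, drawExp, pure_apply]

/-- The expectation of `f` over the runs of the logistic loop of fewer than `n` rounds, as a
function of the remaining time `d = A - T`.  In each round the chosen coin shows heads with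
probability `a` and tails with probability `b`, and `μ` is the law of the waiting times.  Leaving
the loop after heads takes one more unit of fuel, hence the case `n = 0`. -/
noncomputable def gapFuel (μ : Measure ℝ) (a b : ℝ≥0∞) : ℕ → (Bool → ℕ → ℝ≥0∞) → ℝ → ℝ≥0∞
  | 0, _, _ => 0
  | n + 1, f, d =>
    if 0 < d then
      a * (if n = 0 then 0 else f true 1)
        + b * ∫⁻ e, gapFuel μ a b n (fun x m => f x (1 + m)) (d - e) ∂μ
    else f false 0

theorem measurable_gapFuel (μ : Measure ℝ) [SFinite μ] (a b : ℝ≥0∞) (n : ℕ)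
    (f : Bool → ℕ → ℝ≥0∞) : Measurable (gapFuel μ a b n f) := by
  induction n generalizing f with
  | zero => exact measurable_const
  | succ n ih =>
    have := ih fun x m => f x (1 + m)
    exact Measurable.ite measurableSet_Ioi (by fun_prop) measurable_const

/-- The probability that the coin chosen in one round shows heads. -/
theorem sum_index_mul_heads {p c : Fin k → ℝ} (hp : ∀ i, p i ∈ Set.Icc (0 : ℝ) 1)
    (hc : ∀ i, 0 ≤ c i) :
    ∑ i, ENNReal.ofReal (c i / ∑ j, c j) * ENNReal.ofReal (p i)
      = ENNReal.ofReal ((∑ i, c i * p i) / ∑ j, c j) := by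
  have hS : 0 ≤ ∑ j, c j := Finset.sum_nonneg fun i _ => hc i
  rw [Finset.sum_div, ENNReal.ofReal_sum_of_nonneg fun i _ =>
    div_nonneg (mul_nonneg (hc i) (hp i).1) hS]
  refine Finset.sum_congr rfl fun i _ => ?_
  rw [← ENNReal.ofReal_mul (div_nonneg (hc i) hS)]
  congr 1
  ring

/-- The probability that the coin chosen in one round shows tails. -/
theorem sum_index_mul_tails {p c : Fin k → ℝ} (hp : ∀ i, p i ∈ Set.Icc (0 : ℝ) 1)
    (hc : ∀ i, 0 ≤ c i) :
    ∑ i, ENNReal.ofReal (c i / ∑ j, c j) * ENNReal.ofReal (1 - p i)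
      = ENNReal.ofReal ((∑ i, c i - ∑ i, c i * p i) / ∑ j, c j) := by
  rw [sum_index_mul_heads (p := fun i => 1 - p i)
    (fun i => ⟨sub_nonneg.2 (hp i).2, by linarith [(hp i).1]⟩) hc]
  simp [mul_sub]

theorem whileFuel_logisticBody {p c : Fin k → ℝ} (hp : ∀ i, p i ∈ Set.Icc (0 : ℝ) 1)
    (hc : ∀ i, 0 ≤ c i) (A : ℝ) (n : ℕ) (T : ℝ) (f : Bool → ℕ → ℝ≥0∞) :
    whileFuel (fun s : Bool × ℝ => s.1 = false ∧ s.2 < A) (logisticBody p c) n (false, T)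
        (fun s m => f s.1 m)
      = gapFuel (expMeasure (∑ j, c j)) (ENNReal.ofReal ((∑ i, c i * p i) / ∑ j, c j))
          (ENNReal.ofReal ((∑ i, c i - ∑ i, c i * p i) / ∑ j, c j)) n f (A - T) := by
  induction n generalizing T f with
  | zero => rfl
  | succ n ih =>
    by_cases hT : T < A
    · rw [whileFuel_succ_of_pos ⟨rfl, hT⟩, bind_apply, gapFuel, if_pos (sub_pos.2 hT),
        ← sum_index_mul_heads hp hc, ← sum_index_mul_tails hp hc, Finset.sum_mul, Finset.sum_mul,
        ← Finset.sum_add_distrib, logisticBody]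
      refine Finset.sum_congr rfl fun i _ => ?_
      rw [mul_add, mul_assoc, mul_assoc]
      congr 3
      · cases n with
        | zero => rfl
        | succ n =>
          rw [whileFuel_succ_of_neg (by simp)]
          simp [pure_apply]
      · congr 1
        funext e
        rw [sum_index_mul_heads hp hc, sum_index_mul_tails hp hc, sub_sub]
        exact ih (T + e) fun x m => f x (1 + m)
    · rw [whileFuel_succ_of_neg (by simp [hT]), gapFuel, if_neg (by simpa using hT)]
      rfl

/-- The expectation of `f` over the runs of `logisticBF` with fewer than `n` rounds; the weights
`s`, `h`, `t` are the probabilities that a round ends the loop before a flip, with heads, or with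
tails. -/
noncomputable def logisticFuel (s h t : ℝ≥0∞) : ℕ → (Bool → ℕ → ℝ≥0∞) → ℝ≥0∞
  | 0, _ => 0
  | n + 1, f => s * f false 0 + h * (if n = 0 then 0 else f true 1)
      + t * logisticFuel s h t n fun x m => f x (1 + m)

theorem lintegral_gapFuel {r : ℝ} (hr : 0 < r) (a b : ℝ≥0∞) (n : ℕ) (f : Bool → ℕ → ℝ≥0∞) :
    ∫⁻ A, ∫⁻ T, gapFuel (expMeasure r) a b n f (A - T) ∂(expMeasure r) ∂(expMeasure 1)
      = logisticFuel (ENNReal.ofReal (1 / (1 + r))) (ENNReal.ofReal (r / (1 + r)) * a)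
          (ENNReal.ofReal (r / (1 + r)) * b) n f := by
  have := isProbabilityMeasure_expMeasure hr
  have := isProbabilityMeasure_expMeasure one_pos
  induction n generalizing f with
  | zero => simp [gapFuel, logisticFuel]
  | succ n ih =>
    set f' : Bool → ℕ → ℝ≥0∞ := fun x m => f x (1 + m) with hf'
    have hg := measurable_gapFuel (expMeasure r) a b n f'
    set X : ℝ≥0∞ := if n = 0 then 0 else f true 1 with hX
    set F : ℝ → ℝ≥0∞ := fun d => a * X + b * ∫⁻ e, gapFuel (expMeasure r) a b n f' (d - e)
      ∂(expMeasure r) with hF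
    have hFm : Measurable F := by fun_prop
    have hm : Measurable fun z : ℝ × ℝ => if 0 < z.1 - z.2 then F (z.1 - z.2) else 0 :=
      Measurable.ite (measurableSet_lt measurable_const (by fun_prop)) (by fun_prop)
        measurable_const
    have hsplit : ∀ A T : ℝ, gapFuel (expMeasure r) a b (n + 1) f (A - T)
        = (if 0 < A - T then F (A - T) else 0) + (if 0 < A - T then 0 else f false 0) := by
      intro A T
      rw [gapFuel]
      by_cases hd : 0 < A - T
      · simp only [hd, if_true, add_zero]
        rfl
      · simp only [hd, if_false, zero_add]
    have hm' : ∀ A : ℝ, Measurable fun T : ℝ => if 0 < A - T then F (A - T) else 0 :=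
      fun A => hm.comp measurable_prodMk_left
    simp only [hsplit]
    simp only [lintegral_add_left (hm' _)]
    rw [lintegral_add_left hm.lintegral_prod_right', lintegral_race hr hFm,
      lintegral_race_lost hr, logisticFuel, ← ih f', hF,
      lintegral_add_left measurable_const, lintegral_const_mul b (by fun_prop)]
    simp only [lintegral_const, measure_univ, mul_one]
    ring

theorem logisticFuel_mono_fuel (s h t : ℝ≥0∞) (f : Bool → ℕ → ℝ≥0∞) :
    Monotone fun n => logisticFuel s h t n f := by
  refine monotone_nat_of_le_succ fun n => ?_
  induction n generalizing f with
  | zero => exact zero_le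
  | succ n ih =>
    rw [logisticFuel, logisticFuel]
    gcongr
    · split_ifs <;> simp_all
    · exact ih _

theorem gapFuel_mono_fuel (μ : Measure ℝ) (a b : ℝ≥0∞) (f : Bool → ℕ → ℝ≥0∞) (d : ℝ) :
    Monotone fun n => gapFuel μ a b n f d := by
  refine monotone_nat_of_le_succ fun n => ?_
  induction n generalizing f d with
  | zero => exact zero_le
  | succ n ih =>
    rw [gapFuel, gapFuel]
    split_ifs <;> first | exact le_rfl | skip
    all_goals gcongr
    all_goals first | exact ih _ _ | simp_all

theorem logisticBF_eq_iSup {p c : Fin k → ℝ} (hp : ∀ i, p i ∈ Set.Icc (0 : ℝ) 1)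
    (hc : ∀ i, 0 ≤ c i) (hC : 0 < ∑ i, c i) (f : Bool → ℕ → ℝ≥0∞) :
    logisticBF p c f = ⨆ n, logisticFuel (ENNReal.ofReal (1 / (1 + ∑ i, c i)))
      (ENNReal.ofReal ((∑ i, c i * p i) / (1 + ∑ i, c i)))
      (ENNReal.ofReal ((∑ i, c i - ∑ i, c i * p i) / (1 + ∑ i, c i))) n f := by
  have := isProbabilityMeasure_expMeasure hC
  rw [logisticBF_eq_lintegral]
  simp only [whileFuel_logisticBody hp hc]
  have hmul : ∀ x : ℝ, ENNReal.ofReal (x / (1 + ∑ i, c i))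
      = ENNReal.ofReal ((∑ i, c i) / (1 + ∑ i, c i)) * ENNReal.ofReal (x / ∑ i, c i) := by
    intro x
    rw [← ENNReal.ofReal_mul (by positivity)]
    congr 1
    field_simp
  rw [hmul (∑ i, c i * p i), hmul (∑ i, c i - ∑ i, c i * p i)]
  simp only [← lintegral_gapFuel hC]
  have hm := fun n => measurable_gapFuel (expMeasure (∑ i, c i))
    (ENNReal.ofReal ((∑ i, c i * p i) / ∑ j, c j))
    (ENNReal.ofReal ((∑ i, c i - ∑ i, c i * p i) / ∑ j, c j)) n f
  rw [← lintegral_iSup]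
  · refine lintegral_congr fun A => ?_
    rw [lintegral_iSup]
    · exact fun n => (hm n).comp (by fun_prop)
    · exact fun n n' hn T => gapFuel_mono_fuel _ _ _ _ _ hn
  · intro n
    have := hm n
    fun_prop
  · exact fun n n' hn A => lintegral_mono fun T => gapFuel_mono_fuel _ _ _ _ _ hn

theorem logisticFuel_isLaw {s h t : ℝ≥0∞} (hsum : s + h + t ≤ 1) (n : ℕ) :
    IsLaw (logisticFuel s h t n : Run Bool) where
  mono f g hfg := by
    induction n generalizing f g with
    | zero => exact le_rfl
    | succ n ih =>
      rw [logisticFuel, logisticFuel]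
      gcongr
      · exact hfg _ _
      · split_ifs
        exacts [le_rfl, hfg _ _]
      · exact ih _ _ fun _ _ => hfg _ _
  add f g := by
    induction n generalizing f g with
    | zero => exact (add_zero _).symm
    | succ n ih =>
      rw [logisticFuel, logisticFuel, logisticFuel, ih]
      split_ifs <;> ring
  smul x f := by
    induction n generalizing f with
    | zero => exact (mul_zero _).symm
    | succ n ih =>
      rw [logisticFuel, logisticFuel, ih]
      split_ifs <;> ring
  mass_le := by
    induction n with
    | zero => exact zero_le_one
    | succ n ih =>
      rw [logisticFuel]
      refine le_trans ?_ hsum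
      gcongr
      · simp
      · exact mul_le_of_le_one_right zero_le (by split_ifs <;> simp)
      · exact mul_le_of_le_one_right zero_le ih

theorem iSup_logisticFuel (s h t : ℝ≥0∞) (f : Bool → ℕ → ℝ≥0∞) :
    ⨆ n, logisticFuel s h t n f
      = s * f false 0 + h * f true 1 + t * ⨆ n, logisticFuel s h t n fun x m => f x (1 + m) := by
  apply le_antisymm
  · refine iSup_le fun n => ?_
    cases n with
    | zero => exact zero_le
    | succ n =>
      rw [logisticFuel]
      gcongr
      · split_ifs <;> simp
      · exact le_iSup (fun n => logisticFuel s h t n fun x m => f x (1 + m)) n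
  · rw [← (logisticFuel_mono_fuel s h t fun x m => f x (1 + m)).iSup_nat_add 1, ENNReal.mul_iSup,
      ENNReal.add_iSup]
    refine iSup_le fun n => le_trans ?_ (le_iSup _ (n + 2))
    rw [show logisticFuel s h t (n + 2) f = s * f false 0 + h * (if n + 1 = 0 then 0 else f true 1)
      + t * logisticFuel s h t (n + 1) fun x m => f x (1 + m) from rfl, if_neg n.succ_ne_zero]

section Parameters

variable {p c : Fin k → ℝ}

theorem sum_mul_nonneg (hp : ∀ i, p i ∈ Set.Icc (0 : ℝ) 1) (hc : ∀ i, 0 ≤ c i) :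
    0 ≤ ∑ i, c i * p i :=
  Finset.sum_nonneg fun i _ => mul_nonneg (hc i) (hp i).1

theorem sum_mul_le_sum (hp : ∀ i, p i ∈ Set.Icc (0 : ℝ) 1) (hc : ∀ i, 0 ≤ c i) :
    ∑ i, c i * p i ≤ ∑ i, c i :=
  Finset.sum_le_sum fun i _ => mul_le_of_le_one_right (hc i) (hp i).2

/-- The three ends of a round of `logisticBF` exhaust all possibilities. -/
theorem logistic_weights_le_one (hp : ∀ i, p i ∈ Set.Icc (0 : ℝ) 1)
    (hc : ∀ i, 0 ≤ c i) (hC : 0 < ∑ i, c i) :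
    ENNReal.ofReal (1 / (1 + ∑ i, c i))
      + ENNReal.ofReal ((∑ i, c i * p i) / (1 + ∑ i, c i))
      + ENNReal.ofReal ((∑ i, c i - ∑ i, c i * p i) / (1 + ∑ i, c i)) ≤ 1 := by
  have h0 := sum_mul_nonneg hp hc
  have h1 := sub_nonneg.2 (sum_mul_le_sum hp hc)
  rw [← ENNReal.ofReal_add (by positivity) (by positivity),
    ← ENNReal.ofReal_add (by positivity) (by positivity), ENNReal.ofReal_le_one]
  apply le_of_eq
  field_simp
  ring

theorem logisticBF_isLaw (hp : ∀ i, p i ∈ Set.Icc (0 : ℝ) 1) (hc : ∀ i, 0 ≤ c i)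
    (hC : 0 < ∑ i, c i) : IsLaw (logisticBF p c) := by
  have h := IsLaw.limitRun (logisticFuel_isLaw (logistic_weights_le_one hp hc hC))
    (logisticFuel_mono_fuel _ _ _)
  convert h using 1
  funext f
  exact logisticBF_eq_iSup hp hc hC f

/-- Solution of a linear fixed point equation with a finite unknown. -/
theorem eq_ofReal_of_eq_add_mul {x : ℝ≥0∞} {a t y : ℝ} (ha : 0 ≤ a) (ht : 0 ≤ t) (ht1 : t < 1)
    (hx : x ≤ 1) (h : x = ENNReal.ofReal a + ENNReal.ofReal t * x) (hy : a = y * (1 - t)) :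
    x = ENNReal.ofReal y := by
  have hx' : x ≠ ⊤ := ne_top_of_le_ne_top ENNReal.one_ne_top hx
  have h' := congrArg ENNReal.toReal h
  rw [ENNReal.toReal_add (by finiteness) (by finiteness), ENNReal.toReal_mul,
    ENNReal.toReal_ofReal ha, ENNReal.toReal_ofReal ht] at h'
  rw [← ENNReal.ofReal_toReal hx']
  congr 1
  have : (x.toReal - y) * (1 - t) = 0 := by linarith
  rcases mul_eq_zero.1 this with h | h <;> linarith

theorem probOutput_le_one {R : Run Bool} (hR : IsLaw R) (b : Bool) : probOutput R b ≤ 1 :=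
  (hR.mono _ _ fun a _ => by split_ifs <;> simp).trans hR.mass_le

/-- A logistic Bernoulli factory returns `1` with probability `r / (1 + r)`. -/
theorem probOutput_logisticBF_true (hp : ∀ i, p i ∈ Set.Icc (0 : ℝ) 1) (hc : ∀ i, 0 ≤ c i)
    (hC : 0 < ∑ i, c i) :
    probOutput (logisticBF p c) true
      = ENNReal.ofReal ((∑ i, c i * p i) / (1 + ∑ i, c i * p i)) := by
  have h0 := sum_mul_nonneg hp hc
  have h1 := sub_nonneg.2 (sum_mul_le_sum hp hc)
  refine eq_ofReal_of_eq_add_mul (a := (∑ i, c i * p i) / (1 + ∑ i, c i))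
    (t := (∑ i, c i - ∑ i, c i * p i) / (1 + ∑ i, c i)) (by positivity) (by positivity)
    ((div_lt_one (by positivity)).2 (by linarith))
    (probOutput_le_one (logisticBF_isLaw hp hc hC) _) ?_ ?_
  · rw [probOutput, logisticBF_eq_iSup hp hc hC]
    refine (iSup_logisticFuel _ _ _ _).trans ?_
    simp
  · field_simp
    ring

theorem probOutput_logisticBF_false (hp : ∀ i, p i ∈ Set.Icc (0 : ℝ) 1) (hc : ∀ i, 0 ≤ c i)
    (hC : 0 < ∑ i, c i) :
    probOutput (logisticBF p c) false = ENNReal.ofReal (1 / (1 + ∑ i, c i * p i)) := by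
  have h0 := sum_mul_nonneg hp hc
  have h1 := sub_nonneg.2 (sum_mul_le_sum hp hc)
  refine eq_ofReal_of_eq_add_mul (a := 1 / (1 + ∑ i, c i))
    (t := (∑ i, c i - ∑ i, c i * p i) / (1 + ∑ i, c i)) (by positivity) (by positivity)
    ((div_lt_one (by positivity)).2 (by linarith))
    (probOutput_le_one (logisticBF_isLaw hp hc hC) _) ?_ ?_
  · rw [probOutput, logisticBF_eq_iSup hp hc hC]
    refine (iSup_logisticFuel _ _ _ _).trans ?_
    simp
  · field_simp
    ring

theorem expectedFlips_logisticBF_le (hp : ∀ i, p i ∈ Set.Icc (0 : ℝ) 1) (hc : ∀ i, 0 ≤ c i)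
    (hC : 0 < ∑ i, c i) :
    expectedFlips (logisticBF p c) ≤ ENNReal.ofReal ((∑ i, c i) / (1 + ∑ i, c i * p i)) := by
  have h0 := sum_mul_nonneg hp hc
  have h1 := sub_nonneg.2 (sum_mul_le_sum hp hc)
  rw [expectedFlips, logisticBF_eq_iSup hp hc hC]
  refine iSup_le fun n => ?_
  induction n with
  | zero => exact zero_le
  | succ n ih =>
    have hs := (logisticFuel_isLaw (logistic_weights_le_one hp hc hC) n).shifted_flips_le 1
    rw [logisticFuel]
    calc _ ≤ ENNReal.ofReal (1 / (1 + ∑ i, c i)) * 0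
          + ENNReal.ofReal ((∑ i, c i * p i) / (1 + ∑ i, c i)) * 1
          + ENNReal.ofReal ((∑ i, c i - ∑ i, c i * p i) / (1 + ∑ i, c i))
            * (1 + ENNReal.ofReal ((∑ i, c i) / (1 + ∑ i, c i * p i))) := by
          gcongr
          · simp
          · split_ifs <;> simp
          · exact hs.trans (by simpa using add_le_add_right ih 1)
      _ = _ := by
        rw [mul_zero, zero_add, mul_one, ← ENNReal.ofReal_one,
          ← ENNReal.ofReal_add zero_le_one (by positivity), ← ENNReal.ofReal_mul (by positivity),
          ← ENNReal.ofReal_add (by positivity) (by positivity)]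
        congr 1
        field_simp
        ring

end Parameters

end Logistic
/-! ### Gambler's ruin walks driven by a logistic coin -/

/-- The function `φ` on the interval `{0, …, m}`, extended by `∞` to the states outside the
interval, which the walks do not reach. -/
noncomputable def onRange (m : ℤ) (φ : ℕ → ℝ) (I : ℤ) : ℝ≥0∞ :=
  if 0 ≤ I ∧ I ≤ m then ENNReal.ofReal (φ I.toNat) else ⊤

theorem onRange_natCast (m : ℤ) (φ : ℕ → ℝ) {n : ℕ} (hn : (n : ℤ) ≤ m) :
    onRange m φ n = ENNReal.ofReal (φ n) := by
  simp [onRange, hn]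

theorem onRange_step {a b x : ℝ} (ha : 0 ≤ a) (hb : 0 ≤ b) (hx : 0 ≤ x) {m : ℤ} {φ : ℕ → ℝ}
    (hφ : ∀ n : ℕ, (n : ℤ) ≤ m → 0 ≤ φ n)
    (hstep : ∀ n : ℕ, (n : ℤ) + 2 ≤ m → x + (a * φ n + b * φ (n + 2)) ≤ φ (n + 1))
    {I : ℤ} (h0 : I ≠ 0) (hm : I ≠ m) :
    ENNReal.ofReal x + (ENNReal.ofReal a * onRange m φ (I - 1)
      + ENNReal.ofReal b * onRange m φ (I + 1)) ≤ onRange m φ I := by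
  by_cases h : 0 ≤ I ∧ I ≤ m
  · obtain ⟨n, rfl⟩ : ∃ n : ℕ, I = (n + 1 : ℕ) := ⟨(I - 1).toNat, by omega⟩
    have e1 : ((n + 1 : ℕ) : ℤ) - 1 = (n : ℕ) := by push_cast; ring
    have e2 : ((n + 1 : ℕ) : ℤ) + 1 = (n + 2 : ℕ) := by push_cast; ring
    have h1 := hφ n (by omega)
    have h2 := hφ (n + 2) (by omega)
    rw [e1, e2, onRange_natCast _ _ (by omega), onRange_natCast _ _ (by omega),
      onRange_natCast _ _ (by omega), ← ENNReal.ofReal_mul ha, ← ENNReal.ofReal_mul hb,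
      ← ENNReal.ofReal_add (by positivity) (by positivity),
      ← ENNReal.ofReal_add hx (by positivity)]
    exact ENNReal.ofReal_le_ofReal (hstep n (by omega))
  · rw [onRange.eq_def m φ I, if_neg h]
    exact le_top

/-- `1` and `ρ ^ n` are harmonic for the walk that moves down with odds `ρ : 1`. -/
theorem harmonic_pow {ρ : ℝ} (h0 : 0 ≤ ρ) (u v : ℝ) (n : ℕ) :
    ρ / (1 + ρ) * (u + v * ρ ^ n) + 1 / (1 + ρ) * (u + v * ρ ^ (n + 2))
      = u + v * ρ ^ (n + 1) := by
  field_simp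
  ring

/-- Concavity of the exit position of the walk as a function of its starting point. -/
theorem mul_one_sub_pow_le {ρ : ℝ} (h0 : 0 ≤ ρ) (h1 : ρ ≤ 1) {n m : ℕ} (hn : n ≤ m) :
    n * (1 - ρ ^ m) ≤ m * (1 - ρ ^ n) := by
  have key : ∀ j : ℕ, j * (1 - ρ ^ (j + 1)) ≤ (j + 1) * (1 - ρ ^ j) := by
    intro j
    have h : ∀ j : ℕ, j * ρ ^ j * (1 - ρ) ≤ 1 - ρ ^ j := by
      intro j
      induction j with
      | zero => simp
      | succ j ih =>
        have := mul_le_mul_of_nonneg_right ih h0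
        have := pow_nonneg h0 j
        push_cast
        rw [pow_succ]
        have hp : ρ ^ j ≤ 1 := pow_le_one₀ h0 h1
        nlinarith [mul_nonneg (sub_nonneg.2 h1) (sub_nonneg.2 hp),
          mul_nonneg this (mul_nonneg (sub_nonneg.2 h1) (sub_nonneg.2 h1))]
    have := h j
    rw [pow_succ]
    nlinarith
  induction m, hn using Nat.le_induction with
  | base => exact le_rfl
  | succ m hnm ih =>
    rcases Nat.eq_zero_or_pos m with rfl | hm
    · obtain rfl : n = 0 := by omega
      simp
    · have hm' : (0 : ℝ) < m := by exact_mod_cast hm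
      have h1 := mul_le_mul_of_nonneg_left (key m) (Nat.cast_nonneg (α := ℝ) n)
      have h2 := mul_le_mul_of_nonneg_left ih (by positivity : (0 : ℝ) ≤ m + 1)
      push_cast
      refine le_of_mul_le_mul_left ?_ hm'
      nlinarith

/-- A coin with odds `ρ : 1` of heads whose flips cost `κ / (1 + ρ)` flips on average, as
implemented by the logistic Bernoulli factory.  The odds are below `1`, so that the walks driven by
the coin have a drift. -/
structure IsLogistic (R : Run Bool) (ρ κ : ℝ) : Prop where
  law : IsLaw R
  prob_true : probOutput R true = ENNReal.ofReal (ρ / (1 + ρ))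
  prob_false : probOutput R false = ENNReal.ofReal (1 / (1 + ρ))
  flips_le : expectedFlips R ≤ ENNReal.ofReal (κ / (1 + ρ))
  odds_nonneg : 0 ≤ ρ
  odds_lt_one : ρ < 1
  cost_nonneg : 0 ≤ κ

theorem logisticBF_isLogistic {k : ℕ} {p c : Fin k → ℝ} (hp : ∀ i, p i ∈ Set.Icc (0 : ℝ) 1)
    (hc : ∀ i, 0 ≤ c i) (hC : 0 < ∑ i, c i) (hr : ∑ i, c i * p i < 1) :
    IsLogistic (logisticBF p c) (∑ i, c i * p i) (∑ i, c i) :=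
  ⟨logisticBF_isLaw hp hc hC, probOutput_logisticBF_true hp hc hC,
    probOutput_logisticBF_false hp hc hC, expectedFlips_logisticBF_le hp hc hC,
    sum_mul_nonneg hp hc, hr, hC.le⟩

theorem IsLogistic.mass {R : Run Bool} {ρ κ : ℝ} (h : IsLogistic R ρ κ) :
    R (fun _ _ => 1) = 1 := by
  have h0 := h.odds_nonneg
  rw [h.law.mass_bool, h.prob_true, h.prob_false, ← ENNReal.ofReal_add (by positivity)
    (by positivity), ← add_div, add_comm ρ, div_self (by positivity), ENNReal.ofReal_one]

/-- The walk on `ℤ` started at `1`, moved by `heads` or `tails` according to the coin `R` as long as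
`cond` holds; it returns whether the exit position satisfies `win`. -/
noncomputable def walk (R : Run Bool) (cond : ℤ → Prop) (heads tails : ℤ → ℤ) (win : ℤ → Prop)
    [DecidablePred win] : Run Bool :=
  whileLoop cond (fun I => R >>= fun B => pure (if B then heads I else tails I)) 1
    >>= fun I => pure (decide (win I))

section Walk

variable {R : Run Bool} {ρ κ : ℝ} {cond : ℤ → Prop} {heads tails : ℤ → ℤ} {win : ℤ → Prop}
  [DecidablePred win]

theorem walk_body_isLaw (hR : IsLaw R) (I : ℤ) :
    IsLaw (R >>= fun B => pure (if B then heads I else tails I)) :=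
  hR.bind fun _ => IsLaw.pure _

theorem walk_body_apply (hR : IsLogistic R ρ κ) (Φ : ℤ → ℝ≥0∞) (I : ℤ) :
    (R >>= fun B => pure (if B then heads I else tails I)) (fun I' _ => Φ I')
      = ENNReal.ofReal (ρ / (1 + ρ)) * Φ (heads I)
        + ENNReal.ofReal (1 / (1 + ρ)) * Φ (tails I) := by
  rw [← hR.prob_true, ← hR.prob_false]
  exact hR.law.apply_bool fun B => Φ (if B then heads I else tails I)

theorem walk_isLaw (hR : IsLaw R) : IsLaw (walk R cond heads tails win) :=
  (whileLoop_isLaw (fun I _ => walk_body_isLaw hR I) _).bind fun _ => IsLaw.pure _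

theorem probOutput_walk_le (hR : IsLogistic R ρ κ) {Φ : ℤ → ℝ≥0∞} (b : Bool)
    (hexit : ∀ I, ¬ cond I → decide (win I) = b → 1 ≤ Φ I)
    (hstep : ∀ I, cond I → ENNReal.ofReal (ρ / (1 + ρ)) * Φ (heads I)
      + ENNReal.ofReal (1 / (1 + ρ)) * Φ (tails I) ≤ Φ I) :
    probOutput (walk R cond heads tails win) b ≤ Φ 1 := by
  refine whileLoop_le (g := fun I => if decide (win I) = b then 1 else 0)
    (fun I _ => walk_body_isLaw hR.law I) (fun I hI => ?_) (fun I hI => ?_) 1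
  · split_ifs with h
    exacts [hexit I hI h, zero_le]
  · rw [walk_body_apply hR]
    exact hstep I hI

theorem expectedFlips_walk_le (hR : IsLogistic R ρ κ) {Φ : ℤ → ℝ≥0∞}
    (hstep : ∀ I, cond I → ENNReal.ofReal (κ / (1 + ρ))
      + (ENNReal.ofReal (ρ / (1 + ρ)) * Φ (heads I)
      + ENNReal.ofReal (1 / (1 + ρ)) * Φ (tails I)) ≤ Φ I) :
    expectedFlips (walk R cond heads tails win) ≤ Φ 1 := by
  refine whileLoop_flips_le (fun I _ => walk_body_isLaw hR.law I) (fun I hI => ?_) 1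
  rw [walk_body_apply hR]
  exact (add_le_add_left hR.flips_le _).trans (hstep I hI)

theorem walk_mass (hR : IsLogistic R ρ κ) {Φ : ℤ → ℝ≥0∞} (hΦ : Φ 1 ≠ ⊤)
    (hstep : ∀ I, cond I → ENNReal.ofReal 1 + (ENNReal.ofReal (ρ / (1 + ρ)) * Φ (heads I)
      + ENNReal.ofReal (1 / (1 + ρ)) * Φ (tails I)) ≤ Φ I) :
    probOutput (walk R cond heads tails win) true
      + probOutput (walk R cond heads tails win) false = 1 := by
  rw [← (walk_isLaw hR.law).mass_bool]
  refine whileLoop_mass (fun I _ => walk_body_isLaw hR.law I) (fun I _ => hR.mass)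
    (fun I hI => ?_) 1 hΦ
  rw [walk_body_apply hR, ← ENNReal.ofReal_one]
  exact hstep I hI

end Walk

/-! ### Algorithm `A` -/

section AlgA

variable {k : ℕ} {p c : Fin k → ℝ} {ρ κ : ℝ}

theorem algA_eq_walk (p : Fin k → ℝ) (m : ℤ) (c : Fin k → ℝ) :
    algA p m c = walk (logisticBF p c) (fun I => I ≠ 0 ∧ I ≠ m) (fun I => I - 1)
      (fun I => I + 1) (fun I => I = 0) := by
  have : ∀ I : ℤ, ∀ B : Bool,
      I + 1 - 2 * (if B then 1 else 0) = if B then I - 1 else I + 1 := by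
    intro I B
    cases B <;> simp
    ring
  simp only [algA, walk, this]

theorem algA_isLaw (h : IsLogistic (logisticBF p c) ρ κ) (m : ℤ) : IsLaw (algA p m c) := by
  rw [algA_eq_walk]
  exact walk_isLaw h.law

theorem one_sub_pow_pos {ρ : ℝ} (h0 : 0 ≤ ρ) (h1 : ρ < 1) {m : ℕ} (hm : m ≠ 0) :
    0 < 1 - ρ ^ m :=
  sub_pos.2 (pow_lt_one₀ h0 h1 hm)

theorem probOutput_algA_true_le (h : IsLogistic (logisticBF p c) ρ κ) {m : ℕ} (hm : m ≠ 0) :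
    probOutput (algA p m c) true ≤ ENNReal.ofReal ((ρ - ρ ^ m) / (1 - ρ ^ m)) := by
  have h0 := h.odds_nonneg
  have hpos := one_sub_pow_pos h0 h.odds_lt_one hm
  rw [algA_eq_walk]
  set φ : ℕ → ℝ := fun n => (ρ ^ n - ρ ^ m) / (1 - ρ ^ m) with hφ
  refine (probOutput_walk_le h (Φ := onRange m φ) true ?_ ?_).trans_eq ?_
  · intro I _ hI
    obtain rfl : I = (0 : ℕ) := by simpa using hI
    rw [onRange_natCast _ _ (by omega), hφ]
    simp [div_self hpos.ne']
  · intro I hI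
    have := onRange_step (a := ρ / (1 + ρ)) (b := 1 / (1 + ρ)) (x := 0) (m := m) (φ := φ)
      (by positivity) (by positivity) le_rfl
      (fun n hn => div_nonneg (sub_nonneg.2 (pow_le_pow_of_le_one h0 h.odds_lt_one.le
        (by exact_mod_cast hn))) hpos.le) (fun n _ => ?_) hI.1 hI.2
    · simpa using this
    · have := harmonic_pow h0 (-ρ ^ m / (1 - ρ ^ m)) (1 / (1 - ρ ^ m)) n
      have e : ∀ n, φ n = -ρ ^ m / (1 - ρ ^ m) + 1 / (1 - ρ ^ m) * ρ ^ n := fun n => by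
        simp only [hφ]; ring
      rw [zero_add, e, e, e]
      exact this.le
  · have := onRange_natCast m φ (n := 1) (by omega)
    simpa [hφ] using this

theorem probOutput_algA_false_le (h : IsLogistic (logisticBF p c) ρ κ) {m : ℕ} (hm : m ≠ 0) :
    probOutput (algA p m c) false ≤ ENNReal.ofReal ((1 - ρ) / (1 - ρ ^ m)) := by
  have h0 := h.odds_nonneg
  have hpos := one_sub_pow_pos h0 h.odds_lt_one hm
  rw [algA_eq_walk]
  set φ : ℕ → ℝ := fun n => (1 - ρ ^ n) / (1 - ρ ^ m) with hφ
  refine (probOutput_walk_le h (Φ := onRange m φ) false ?_ ?_).trans_eq ?_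
  · intro I hc hI
    obtain rfl : I = m := by
      by_contra hne
      exact hc ⟨by simpa using hI, hne⟩
    rw [onRange_natCast _ _ le_rfl, hφ]
    simp [div_self hpos.ne']
  · intro I hI
    have := onRange_step (a := ρ / (1 + ρ)) (b := 1 / (1 + ρ)) (x := 0) (m := m) (φ := φ)
      (by positivity) (by positivity) le_rfl
      (fun n _ => div_nonneg (sub_nonneg.2 (pow_le_one₀ h0 h.odds_lt_one.le)) hpos.le)
      (fun n _ => ?_) hI.1 hI.2
    · simpa using this
    · have := harmonic_pow h0 (1 / (1 - ρ ^ m)) (-1 / (1 - ρ ^ m)) n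
      have e : ∀ n, φ n = 1 / (1 - ρ ^ m) + -1 / (1 - ρ ^ m) * ρ ^ n := fun n => by
        simp only [hφ]; ring
      rw [zero_add, e, e, e]
      exact this.le
  · have := onRange_natCast m φ (n := 1) (by omega)
    simpa [hφ] using this

theorem algA_mass (h : IsLogistic (logisticBF p c) ρ κ) {m : ℕ} (hm : m ≠ 0) :
    probOutput (algA p m c) true + probOutput (algA p m c) false = 1 := by
  have h0 := h.odds_nonneg
  have h1 := sub_pos.2 h.odds_lt_one
  rw [algA_eq_walk]
  set φ : ℕ → ℝ := fun n => (m - n) * (1 + ρ) / (1 - ρ) with hφ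
  have hone := onRange_natCast m φ (n := 1) (by omega)
  refine walk_mass h (Φ := onRange m φ) (by rw [Nat.cast_one] at hone; rw [hone]; finiteness)
    fun I hI => ?_
  refine onRange_step (by positivity) (by positivity) zero_le_one (fun n hn => ?_)
    (fun n _ => ?_) hI.1 hI.2
  · have : (n : ℝ) ≤ m := by exact_mod_cast hn
    have := sub_nonneg.2 this
    positivity
  · simp only [hφ]
    apply le_of_eq
    push_cast
    field_simp
    ring

theorem expectedFlips_algA_le (h : IsLogistic (logisticBF p c) ρ κ) {m : ℕ} (hm : m ≠ 0) :
    expectedFlips (algA p m c)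
      ≤ ENNReal.ofReal (κ * (m / (1 - ρ ^ m) - 1 / (1 - ρ))) := by
  have h0 := h.odds_nonneg
  have hκ := h.cost_nonneg
  have h1 := sub_pos.2 h.odds_lt_one
  have hpos := one_sub_pow_pos h0 h.odds_lt_one hm
  rw [algA_eq_walk]
  -- The drift of the walk is `(1 - ρ) / (1 + ρ)`, and `m (1 - ρ ^ n) / (1 - ρ ^ m)` is the
  -- expected exit position of the walk started at `n`.
  set φ : ℕ → ℝ := fun n => κ * ((m * (1 - ρ ^ n) / (1 - ρ ^ m) - n) / (1 - ρ)) with hφ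
  refine (expectedFlips_walk_le h (Φ := onRange m φ) ?_).trans_eq ?_
  · intro I hI
    refine onRange_step (by positivity) (by positivity) (by positivity) (fun n hn => ?_)
      (fun n _ => ?_) hI.1 hI.2
    · refine mul_nonneg hκ (div_nonneg ?_ h1.le)
      rw [sub_nonneg, le_div_iff₀ hpos]
      exact mul_one_sub_pow_le h0 h.odds_lt_one.le (by exact_mod_cast hn)
    · simp only [hφ]
      apply le_of_eq
      push_cast
      field_simp
      ring
  · have := onRange_natCast m φ (n := 1) (by omega)
    rw [Nat.cast_one] at this
    rw [this]
    simp only [hφ]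
    congr 1
    push_cast
    field_simp

end AlgA

/-! ### The high power logistic Bernoulli factory -/

section HighPower

variable {k : ℕ} {p c : Fin k → ℝ} {β ρ κ : ℝ}

theorem highPowerLogisticBF_eq_walk (p : Fin k → ℝ) (m : ℤ) (β : ℝ) (c : Fin k → ℝ) :
    highPowerLogisticBF p m β c = walk (logisticBF p fun i => β * c i)
      (fun s => 1 ≤ s ∧ s ≤ m) (fun s => s + 1) (fun s => s - 1) (fun s => s = m + 1) := rfl

theorem highPowerLogisticBF_isLaw (h : IsLogistic (logisticBF p fun i => β * c i) ρ κ) (m : ℤ) :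
    IsLaw (highPowerLogisticBF p m β c) := by
  rw [highPowerLogisticBF_eq_walk]
  exact walk_isLaw h.law

/-- The walk that moves up with odds `ρ : 1` is the reflection of the one that moves down. -/
theorem harmonic_pow_reflected {ρ : ℝ} (h0 : 0 ≤ ρ) (u v : ℝ) {n M : ℕ} (hn : n + 2 ≤ M) :
    1 / (1 + ρ) * (u + v * ρ ^ (M - n)) + ρ / (1 + ρ) * (u + v * ρ ^ (M - (n + 2)))
      = u + v * ρ ^ (M - (n + 1)) := by
  obtain ⟨d, rfl⟩ := Nat.exists_eq_add_of_le hn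
  have e1 : n + 2 + d - n = d + 2 := by omega
  have e2 : n + 2 + d - (n + 2) = d := by omega
  have e3 : n + 2 + d - (n + 1) = d + 1 := by omega
  rw [e1, e2, e3, add_comm]
  exact harmonic_pow h0 u v d

theorem probOutput_highPowerLogisticBF_true_le
    (h : IsLogistic (logisticBF p fun i => β * c i) ρ κ) (m : ℕ) :
    probOutput (highPowerLogisticBF p m β c) true
      ≤ ENNReal.ofReal ((ρ ^ m - ρ ^ (m + 1)) / (1 - ρ ^ (m + 1))) := by
  have h0 := h.odds_nonneg
  have hpos := one_sub_pow_pos h0 h.odds_lt_one m.succ_ne_zero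
  rw [highPowerLogisticBF_eq_walk]
  set φ : ℕ → ℝ := fun n => (ρ ^ (m + 1 - n) - ρ ^ (m + 1)) / (1 - ρ ^ (m + 1)) with hφ
  refine (probOutput_walk_le h (Φ := onRange (m + 1) φ) true ?_ ?_).trans_eq ?_
  · intro I _ hI
    obtain rfl : I = (m + 1 : ℕ) := by simpa using hI
    rw [onRange_natCast _ _ (by omega), hφ]
    simp [div_self hpos.ne']
  · intro I hI
    have := onRange_step (a := 1 / (1 + ρ)) (b := ρ / (1 + ρ)) (x := 0) (m := m + 1) (φ := φ)
      (by positivity) (by positivity) le_rfl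
      (fun n _ => div_nonneg (sub_nonneg.2 (pow_le_pow_of_le_one h0 h.odds_lt_one.le
        (by omega))) hpos.le) (fun n hn => ?_) (I := I) (by omega) (by omega)
    · simpa [add_comm] using this
    · have := harmonic_pow_reflected h0 (-ρ ^ (m + 1) / (1 - ρ ^ (m + 1))) (1 / (1 - ρ ^ (m + 1)))
        (n := n) (M := m + 1) (by omega)
      have e : ∀ n, φ n = -ρ ^ (m + 1) / (1 - ρ ^ (m + 1))
          + 1 / (1 - ρ ^ (m + 1)) * ρ ^ (m + 1 - n) := fun n => by
        simp only [hφ]; ring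
      rw [zero_add, e, e, e]
      exact this.le
  · have := onRange_natCast (m + 1) φ (n := 1) (by omega)
    simpa [hφ] using this

theorem probOutput_highPowerLogisticBF_false_le
    (h : IsLogistic (logisticBF p fun i => β * c i) ρ κ) (m : ℕ) :
    probOutput (highPowerLogisticBF p m β c) false
      ≤ ENNReal.ofReal ((1 - ρ ^ m) / (1 - ρ ^ (m + 1))) := by
  have h0 := h.odds_nonneg
  have hpos := one_sub_pow_pos h0 h.odds_lt_one m.succ_ne_zero
  rw [highPowerLogisticBF_eq_walk]
  set φ : ℕ → ℝ := fun n => (1 - ρ ^ (m + 1 - n)) / (1 - ρ ^ (m + 1)) with hφ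
  refine (probOutput_walk_le h (Φ := onRange (m + 1) φ) false ?_ ?_).trans_eq ?_
  · intro I hc hI
    by_cases hI0 : I = (0 : ℕ)
    · subst hI0
      rw [onRange_natCast _ _ (by omega), hφ]
      simp [div_self hpos.ne']
    · have hI' : I ≠ m + 1 := by simpa using hI
      rw [onRange, if_neg (by omega)]
      exact le_top
  · intro I hI
    have := onRange_step (a := 1 / (1 + ρ)) (b := ρ / (1 + ρ)) (x := 0) (m := m + 1) (φ := φ)
      (by positivity) (by positivity) le_rfl
      (fun n _ => div_nonneg (sub_nonneg.2 (pow_le_one₀ h0 h.odds_lt_one.le)) hpos.le)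
      (fun n hn => ?_) (I := I) (by omega) (by omega)
    · simpa [add_comm] using this
    · have := harmonic_pow_reflected h0 (1 / (1 - ρ ^ (m + 1))) (-1 / (1 - ρ ^ (m + 1)))
        (n := n) (M := m + 1) (by omega)
      have e : ∀ n, φ n = 1 / (1 - ρ ^ (m + 1))
          + -1 / (1 - ρ ^ (m + 1)) * ρ ^ (m + 1 - n) := fun n => by
        simp only [hφ]; ring
      rw [zero_add, e, e, e]
      exact this.le
  · have := onRange_natCast (m + 1) φ (n := 1) (by omega)
    simpa [hφ] using this

theorem highPowerLogisticBF_mass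
    (h : IsLogistic (logisticBF p fun i => β * c i) ρ κ) {m : ℤ} (hm : 0 ≤ m) :
    probOutput (highPowerLogisticBF p m β c) true
      + probOutput (highPowerLogisticBF p m β c) false = 1 := by
  have h0 := h.odds_nonneg
  have h1 := sub_pos.2 h.odds_lt_one
  rw [highPowerLogisticBF_eq_walk]
  set φ : ℕ → ℝ := fun n => n * (1 + ρ) / (1 - ρ) with hφ
  have hone := onRange_natCast (m + 1) φ (n := 1) (by omega)
  refine walk_mass h (Φ := onRange (m + 1) φ) (by rw [Nat.cast_one] at hone; rw [hone]; finiteness)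
    fun I hI => ?_
  rw [add_comm (ENNReal.ofReal (ρ / (1 + ρ)) * _)]
  refine onRange_step (by positivity) (by positivity) zero_le_one (fun n hn => by positivity)
    (fun n _ => ?_) (by omega) (by omega)
  simp only [hφ]
  apply le_of_eq
  push_cast
  field_simp
  ring

theorem expectedFlips_highPowerLogisticBF_le
    (h : IsLogistic (logisticBF p fun i => β * c i) ρ κ) {m : ℤ} (hm : 0 ≤ m) :
    expectedFlips (highPowerLogisticBF p m β c) ≤ ENNReal.ofReal (κ / (1 - ρ)) := by
  have h0 := h.odds_nonneg
  have hκ := h.cost_nonneg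
  have h1 := sub_pos.2 h.odds_lt_one
  rw [highPowerLogisticBF_eq_walk]
  -- The drift of the walk is `-(1 - ρ) / (1 + ρ)`.
  set φ : ℕ → ℝ := fun n => κ * n / (1 - ρ) with hφ
  refine (expectedFlips_walk_le h (Φ := onRange (m + 1) φ) ?_).trans_eq ?_
  · intro I hI
    rw [add_comm (ENNReal.ofReal (ρ / (1 + ρ)) * _)]
    refine onRange_step (by positivity) (by positivity) (by positivity)
      (fun n hn => by positivity) (fun n _ => ?_) (by omega) (by omega)
    simp only [hφ]
    apply le_of_eq
    push_cast
    field_simp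
    ring
  · have := onRange_natCast (m + 1) φ (n := 1) (by omega)
    rw [Nat.cast_one] at this
    rw [this]
    simp [hφ]

end HighPower
/-! ### Algorithm `B` -/

theorem mul_add_mul_le_ofReal {P P' x y : ℝ≥0∞} {a b u v : ℝ} (hP : P ≤ ENNReal.ofReal a)
    (hP' : P' ≤ ENNReal.ofReal b) (hx : x ≤ ENNReal.ofReal u) (hy : y ≤ ENNReal.ofReal v)
    (ha : 0 ≤ a) (hb : 0 ≤ b) (hu : 0 ≤ u) (hv : 0 ≤ v) :
    P * x + P' * y ≤ ENNReal.ofReal (a * u + b * v) := by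
  rw [ENNReal.ofReal_add (by positivity) (by positivity), ENNReal.ofReal_mul ha,
    ENNReal.ofReal_mul hb]
  gcongr

/-- The loop body of `algB`; `Q` is the recursive call. -/
noncomputable def algBBody {k : ℕ} (Q : Run Bool) (p : Fin k → ℝ) (β : ℝ) (c : Fin k → ℝ)
    (s : Option Bool × ℤ) : Run (Option Bool × ℤ) :=
  Q >>= fun B₁ => if B₁ then
    highPowerLogisticBF p (s.2 - 2) β c >>= fun B₂ =>
      if B₂ then pure (some true, s.2) else pure (none, s.2 - 1)
    else pure (some false, s.2)

/-- A potential for the loop of `algB`: it is `g b` once the output `b` is decided, and `φ j` in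
the undecided state with `m = j + 2`.  The undecided states with `m < 2`, which are not reached,
get the value `∞`. -/
noncomputable def algBPotential (g : Bool → ℝ) (φ : ℕ → ℝ) : Option Bool × ℤ → ℝ≥0∞
  | (some b, _) => ENNReal.ofReal (g b)
  | (none, m) => if 2 ≤ m then ENNReal.ofReal (φ (m - 2).toNat) else ⊤

section AlgB

variable {k : ℕ} {p c : Fin k → ℝ} {ε β ρ κ : ℝ} {lin : ℝ → (Fin k → ℝ) → Run Bool}
  {Q : Run Bool}

theorem algB_eq (lin : ℝ → (Fin k → ℝ) → Run Bool) (p : Fin k → ℝ) (ε : ℝ) (m : ℤ) (β : ℝ)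
    (c : Fin k → ℝ) :
    algB lin p ε m β c = whileLoop (fun s : Option Bool × ℤ => s.1 = none)
      (algBBody (lin (1 - (1 - ε) * β) (fun i => β * c i)) p β c) (none, m)
      >>= fun s => pure (s.1.getD false) := rfl

theorem algBBody_isLaw (h : IsLogistic (logisticBF p fun i => β * c i) ρ κ) (hQ : IsLaw Q)
    (s : Option Bool × ℤ) : IsLaw (algBBody Q p β c s) :=
  hQ.bind fun _ => IsLaw.ite
    (fun _ => (highPowerLogisticBF_isLaw h _).bind fun _ =>
      IsLaw.ite (fun _ => IsLaw.pure _) fun _ => IsLaw.pure _)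
    fun _ => IsLaw.pure _

theorem algB_isLaw (h : IsLogistic (logisticBF p fun i => β * c i) ρ κ)
    (hQ : IsLaw (lin (1 - (1 - ε) * β) fun i => β * c i)) (m : ℤ) :
    IsLaw (algB lin p ε m β c) := by
  rw [algB_eq]
  exact (whileLoop_isLaw (fun s _ => algBBody_isLaw h hQ s) _).bind fun _ => IsLaw.pure _

theorem algBBody_apply (h : IsLogistic (logisticBF p fun i => β * c i) ρ κ) (hQ : IsLaw Q)
    (Φ : Option Bool × ℤ → ℝ≥0∞) (s : Option Bool × ℤ) :
    algBBody Q p β c s (fun s' _ => Φ s') =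
      probOutput Q true *
        (probOutput (highPowerLogisticBF p (s.2 - 2) β c) true * Φ (some true, s.2)
          + probOutput (highPowerLogisticBF p (s.2 - 2) β c) false * Φ (none, s.2 - 1))
      + probOutput Q false * Φ (some false, s.2) := by
  let S : Bool → Run (Option Bool × ℤ) :=
    fun B₂ => if B₂ then pure (some true, s.2) else pure (none, s.2 - 1)
  have h1 := (highPowerLogisticBF_isLaw h (s.2 - 2)).apply_bool fun b => S b fun s' _ => Φ s'
  refine (hQ.apply_bool fun b =>
    (if b then highPowerLogisticBF p (s.2 - 2) β c >>= S else pure (some false, s.2) :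
      Run (Option Bool × ℤ)) fun s' _ => Φ s').trans ?_
  exact congrArg (fun x => probOutput Q true * x + probOutput Q false * Φ (some false, s.2)) h1

theorem algBBody_step (h : IsLogistic (logisticBF p fun i => β * c i) ρ κ) (hQ : IsLaw Q)
    (hQt : probOutput Q true ≤ ENNReal.ofReal ρ)
    (hQf : probOutput Q false ≤ ENNReal.ofReal (1 - ρ))
    {g : Bool → ℝ} {φ : ℕ → ℝ} {x : ℝ} (hg : ∀ b, 0 ≤ g b) (hφ : ∀ j, 0 ≤ φ j) (hx : 0 ≤ x)
    (hzero : x + (ρ * g true + (1 - ρ) * g false) ≤ φ 0)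
    (hsucc : ∀ j, x + (ρ * ((ρ ^ (j + 1) - ρ ^ (j + 1 + 1)) / (1 - ρ ^ (j + 1 + 1)) * g true
      + (1 - ρ ^ (j + 1)) / (1 - ρ ^ (j + 1 + 1)) * φ j) + (1 - ρ) * g false) ≤ φ (j + 1))
    (m : ℤ) :
    ENNReal.ofReal x + algBBody Q p β c (none, m) (fun s' _ => algBPotential g φ s')
      ≤ algBPotential g φ (none, m) := by
  have h0 := h.odds_nonneg
  have h1 := h.odds_lt_one
  have h1' : 0 ≤ 1 - ρ := by linarith
  rw [algBBody_apply h hQ]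
  dsimp only [algBPotential]
  by_cases hm : 2 ≤ m
  · obtain ⟨j, rfl⟩ : ∃ j : ℕ, m = j + 2 := ⟨(m - 2).toNat, by omega⟩
    have e : (j : ℤ) + 2 - 2 = j := by ring
    have ht := probOutput_highPowerLogisticBF_true_le h j
    have hf := probOutput_highPowerLogisticBF_false_le h j
    rw [if_pos hm, e, Int.toNat_natCast]
    cases j with
    | zero =>
      have hf' : probOutput (highPowerLogisticBF p ((0 : ℕ) : ℤ) β c) false = 0 := by
        simpa using hf
      have ht' := probOutput_le_one (highPowerLogisticBF_isLaw h ((0 : ℕ) : ℤ)) true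
      rw [hf', zero_mul, add_zero]
      refine le_trans ?_ (ENNReal.ofReal_le_ofReal hzero)
      rw [ENNReal.ofReal_add hx (add_nonneg (mul_nonneg h0 (hg _)) (mul_nonneg h1' (hg _)))]
      gcongr
      exact mul_add_mul_le_ofReal hQt hQf (mul_le_of_le_one_left zero_le ht') le_rfl h0 h1'
        (hg _) (hg _)
    | succ j =>
      have hpos := one_sub_pow_pos h0 h1 (j + 1).succ_ne_zero
      have hp1 : 0 ≤ (ρ ^ (j + 1) - ρ ^ (j + 1 + 1)) / (1 - ρ ^ (j + 1 + 1)) :=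
        div_nonneg (sub_nonneg.2 (pow_le_pow_of_le_one h0 h1.le (by omega))) hpos.le
      have hp2 : 0 ≤ (1 - ρ ^ (j + 1)) / (1 - ρ ^ (j + 1 + 1)) :=
        div_nonneg (sub_nonneg.2 (pow_le_one₀ h0 h1.le)) hpos.le
      have e1 : (2 : ℤ) ≤ ((j + 1 : ℕ) : ℤ) + 2 - 1 := by push_cast; omega
      have e2 : (((j + 1 : ℕ) : ℤ) + 2 - 1 - 2).toNat = j := by push_cast; omega
      rw [if_pos e1, e2]
      refine le_trans ?_ (ENNReal.ofReal_le_ofReal (hsucc j))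
      have hin : 0 ≤ (ρ ^ (j + 1) - ρ ^ (j + 1 + 1)) / (1 - ρ ^ (j + 1 + 1)) * g true
          + (1 - ρ ^ (j + 1)) / (1 - ρ ^ (j + 1 + 1)) * φ j :=
        add_nonneg (mul_nonneg hp1 (hg _)) (mul_nonneg hp2 (hφ j))
      rw [ENNReal.ofReal_add hx (add_nonneg (mul_nonneg h0 hin) (mul_nonneg h1' (hg _)))]
      gcongr
      exact mul_add_mul_le_ofReal hQt hQf
        (mul_add_mul_le_ofReal ht hf le_rfl le_rfl hp1 hp2 (hg _) (hφ j)) le_rfl h0 h1' hin (hg _)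
  · rw [if_neg hm]
    exact le_top

/-- The probability that algorithm `B` started with `m = j + 2` returns `1`. -/
noncomputable def algBMean (ρ : ℝ) (j : ℕ) : ℝ :=
  (j + 1) * ρ ^ (j + 1) * (1 - ρ) / (1 - ρ ^ (j + 1))

theorem algBMean_zero {ρ : ℝ} (h1 : ρ < 1) : algBMean ρ 0 = ρ := by
  have : 1 - ρ ≠ 0 := by linarith
  simp [algBMean, this]

theorem algBMean_succ {ρ : ℝ} (h0 : 0 ≤ ρ) (h1 : ρ < 1) (j : ℕ) :
    algBMean ρ (j + 1) = ρ * ((ρ ^ (j + 1) - ρ ^ (j + 1 + 1)) / (1 - ρ ^ (j + 1 + 1))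
      + (1 - ρ ^ (j + 1)) / (1 - ρ ^ (j + 1 + 1)) * algBMean ρ j) := by
  have hp1 := (one_sub_pow_pos h0 h1 j.succ_ne_zero).ne'
  have hp2 := (one_sub_pow_pos h0 h1 (j + 1).succ_ne_zero).ne'
  simp only [Nat.succ_eq_add_one] at hp1 hp2
  unfold algBMean
  push_cast
  field_simp
  ring

theorem algBMean_nonneg {ρ : ℝ} (h0 : 0 ≤ ρ) (h1 : ρ < 1) (j : ℕ) : 0 ≤ algBMean ρ j := by
  have := one_sub_pow_pos h0 h1 j.succ_ne_zero
  have := sub_pos.2 h1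
  unfold algBMean
  positivity

theorem one_sub_algBMean_succ {ρ : ℝ} (h0 : 0 ≤ ρ) (h1 : ρ < 1) (j : ℕ) :
    1 - algBMean ρ (j + 1)
      = ρ * ((1 - ρ ^ (j + 1)) / (1 - ρ ^ (j + 1 + 1)) * (1 - algBMean ρ j)) + (1 - ρ) := by
  have hp2 := (one_sub_pow_pos h0 h1 (j + 1).succ_ne_zero).ne'
  simp only [Nat.succ_eq_add_one] at hp2
  rw [algBMean_succ h0 h1]
  field_simp
  ring

theorem algBMean_le_one {ρ : ℝ} (h0 : 0 ≤ ρ) (h1 : ρ < 1) (j : ℕ) : algBMean ρ j ≤ 1 := by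
  induction j with
  | zero => rw [algBMean_zero h1]; exact h1.le
  | succ j ih =>
    have hpos := one_sub_pow_pos h0 h1 (j + 1).succ_ne_zero
    have hp2 : 0 ≤ (1 - ρ ^ (j + 1)) / (1 - ρ ^ (j + 1 + 1)) :=
      div_nonneg (sub_nonneg.2 (pow_le_one₀ h0 h1.le)) hpos.le
    have := mul_nonneg h0 (mul_nonneg hp2 (sub_nonneg.2 ih))
    linarith [one_sub_algBMean_succ h0 h1 j]

theorem probOutput_algB_true_le (h : IsLogistic (logisticBF p fun i => β * c i) ρ κ)
    (hQ : IsLaw (lin (1 - (1 - ε) * β) fun i => β * c i))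
    (hQt : probOutput (lin (1 - (1 - ε) * β) fun i => β * c i) true ≤ ENNReal.ofReal ρ)
    (hQf : probOutput (lin (1 - (1 - ε) * β) fun i => β * c i) false ≤ ENNReal.ofReal (1 - ρ))
    (j : ℕ) :
    probOutput (algB lin p ε (j + 2) β c) true ≤ ENNReal.ofReal (algBMean ρ j) := by
  have h0 := h.odds_nonneg
  have h1 := h.odds_lt_one
  rw [algB_eq]
  refine (whileLoop_le (g := fun s => if s.1.getD false = true then 1 else 0)
    (Φ := algBPotential (fun b => if b then 1 else 0) (algBMean ρ))
    (fun s _ => algBBody_isLaw h hQ s) ?_ ?_ (none, (j : ℤ) + 2)).trans_eq ?_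
  · rintro ⟨_ | b, m⟩ hs
    · exact absurd rfl hs
    · cases b <;> simp [algBPotential]
  · rintro ⟨_ | b, m⟩ hs
    · have := algBBody_step h hQ hQt hQf (g := fun b => if b then 1 else 0) (φ := algBMean ρ)
        (x := 0) (fun b => by split_ifs <;> simp) (algBMean_nonneg h0 h1) le_rfl
        (by simp [algBMean_zero h1]) (fun j => by simp [algBMean_succ h0 h1 j]) m
      simpa using this
    · cases hs
  · simp [algBPotential]

theorem probOutput_algB_false_le (h : IsLogistic (logisticBF p fun i => β * c i) ρ κ)
    (hQ : IsLaw (lin (1 - (1 - ε) * β) fun i => β * c i))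
    (hQt : probOutput (lin (1 - (1 - ε) * β) fun i => β * c i) true ≤ ENNReal.ofReal ρ)
    (hQf : probOutput (lin (1 - (1 - ε) * β) fun i => β * c i) false ≤ ENNReal.ofReal (1 - ρ))
    (j : ℕ) :
    probOutput (algB lin p ε (j + 2) β c) false ≤ ENNReal.ofReal (1 - algBMean ρ j) := by
  have h0 := h.odds_nonneg
  have h1 := h.odds_lt_one
  rw [algB_eq]
  refine (whileLoop_le (g := fun s => if s.1.getD false = false then 1 else 0)
    (Φ := algBPotential (fun b => if b then 0 else 1) (fun j => 1 - algBMean ρ j))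
    (fun s _ => algBBody_isLaw h hQ s) ?_ ?_ (none, (j : ℤ) + 2)).trans_eq ?_
  · rintro ⟨_ | b, m⟩ hs
    · exact absurd rfl hs
    · cases b <;> simp [algBPotential]
  · rintro ⟨_ | b, m⟩ hs
    · have := algBBody_step h hQ hQt hQf (g := fun b => if b then 0 else 1)
        (φ := fun j => 1 - algBMean ρ j) (x := 0) (fun b => by split_ifs <;> simp)
        (fun j => sub_nonneg.2 (algBMean_le_one h0 h1 j)) le_rfl
        (by simp [algBMean_zero h1]) (fun j => by simp [one_sub_algBMean_succ h0 h1 j]) m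
      simpa using this
    · cases hs
  · simp [algBPotential]

/-- The number of rounds of algorithm `B` is dominated by a geometric variable with mean
`1 / (1 - ρ)`. -/
theorem expectedFlips_algB_le (h : IsLogistic (logisticBF p fun i => β * c i) ρ κ)
    (hQ : IsLaw (lin (1 - (1 - ε) * β) fun i => β * c i))
    (hQt : probOutput (lin (1 - (1 - ε) * β) fun i => β * c i) true ≤ ENNReal.ofReal ρ)
    (hQf : probOutput (lin (1 - (1 - ε) * β) fun i => β * c i) false ≤ ENNReal.ofReal (1 - ρ))
    {L : ℝ} (hL : 0 ≤ L)
    (hQL : expectedFlips (lin (1 - (1 - ε) * β) fun i => β * c i) ≤ ENNReal.ofReal L) (j : ℕ) :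
    expectedFlips (algB lin p ε (j + 2) β c)
      ≤ ENNReal.ofReal ((L + ρ * (κ / (1 - ρ))) / (1 - ρ)) := by
  have h0 := h.odds_nonneg
  have h1 := h.odds_lt_one
  have hκ := h.cost_nonneg
  have h1' : 0 < 1 - ρ := by linarith
  set W : ℝ := (L + ρ * (κ / (1 - ρ))) / (1 - ρ) with hW
  have hW0 : 0 ≤ W := by positivity
  have hWeq : L + ρ * (κ / (1 - ρ)) + ρ * W = W := by
    rw [hW]
    field_simp
    ring
  rw [algB_eq]
  refine (whileLoop_flips_le (V := algBPotential (fun _ => 0) fun _ => W)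
    (fun s _ => algBBody_isLaw h hQ s) ?_ (none, (j : ℤ) + 2)).trans_eq ?_
  · rintro ⟨_ | b, m⟩ hs
    · by_cases hm : 2 ≤ m
      · refine le_trans ?_ (algBBody_step h hQ hQt hQf (g := fun _ => 0) (φ := fun _ => W)
          (x := L + ρ * (κ / (1 - ρ))) (fun _ => le_rfl) (fun _ => hW0) (by positivity) ?_ ?_ m)
        · gcongr
          rw [ENNReal.ofReal_add hL (by positivity), ENNReal.ofReal_mul h0]
          refine (flips_bind_le hQ fun _ => IsLaw.ite
            (fun _ => (highPowerLogisticBF_isLaw h _).bind fun _ =>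
              IsLaw.ite (fun _ => IsLaw.pure _) fun _ => IsLaw.pure _)
            fun _ => IsLaw.pure _).trans ?_
          refine add_le_add hQL ?_
          simp only [if_true, Bool.false_eq_true, if_false, pure_apply, Nat.cast_zero, mul_zero,
            add_zero]
          gcongr
          refine (flips_bind_le (highPowerLogisticBF_isLaw h _) fun _ =>
            IsLaw.ite (fun _ => IsLaw.pure _) fun _ => IsLaw.pure _).trans ?_
          simp only [if_true, Bool.false_eq_true, if_false, pure_apply, Nat.cast_zero, mul_zero,
            add_zero]
          exact expectedFlips_highPowerLogisticBF_le h (by omega)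
        · nlinarith [mul_nonneg h0 hW0]
        · intro j
          have hpos := one_sub_pow_pos h0 h1 (j + 1).succ_ne_zero
          have hp2 : (1 - ρ ^ (j + 1)) / (1 - ρ ^ (j + 1 + 1)) ≤ 1 :=
            (div_le_one hpos).2 (sub_le_sub_left
              (pow_le_pow_of_le_one h0 h1.le (by omega)) _)
          have := mul_le_mul_of_nonneg_left (mul_le_of_le_one_left hW0 hp2) h0
          rw [mul_zero, zero_add, mul_zero, add_zero]
          linarith
      · simp [algBPotential, hm]
    · cases hs
  · simp [algBPotential]

theorem one_le_of_forall_one_le_add_pow {x q : ℝ≥0∞} (hq : q < 1) (h : ∀ n : ℕ, 1 ≤ x + q ^ n) :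
    1 ≤ x := by
  have := (ENNReal.tendsto_pow_atTop_nhds_zero_of_lt_one hq).const_add x
  rw [add_zero] at this
  exact ge_of_tendsto' this h

/-- If a recursive call fails to halt with probability at most `δ`, algorithm `B`, which makes at
most `1 / (1 - ρ)` of them on average, fails to halt with probability at most `δ / (1 - ρ)`. -/
theorem one_le_algB_mass_add (h : IsLogistic (logisticBF p fun i => β * c i) ρ κ)
    (hQ : IsLaw (lin (1 - (1 - ε) * β) fun i => β * c i))
    (hQt : probOutput (lin (1 - (1 - ε) * β) fun i => β * c i) true ≤ ENNReal.ofReal ρ)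
    {δ : ℝ} (hδ : 0 ≤ δ)
    (hQm : 1 ≤ probOutput (lin (1 - (1 - ε) * β) fun i => β * c i) true
      + probOutput (lin (1 - (1 - ε) * β) fun i => β * c i) false + ENNReal.ofReal δ) (j : ℕ) :
    1 ≤ probOutput (algB lin p ε (j + 2) β c) true
      + probOutput (algB lin p ε (j + 2) β c) false + ENNReal.ofReal (δ / (1 - ρ)) := by
  have h0 := h.odds_nonneg
  have h1 := h.odds_lt_one
  have h1' : 0 < 1 - ρ := by linarith
  rw [← (algB_isLaw h hQ _).mass_bool, algB_eq]
  set Q := lin (1 - (1 - ε) * β) fun i => β * c i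
  set D := ENNReal.ofReal (δ / (1 - ρ)) with hD
  set r := ENNReal.ofReal ρ with hr
  have hDeq : ENNReal.ofReal δ + r * D = D := by
    rw [hD, hr, ← ENNReal.ofReal_mul h0, ← ENNReal.ofReal_add hδ (by positivity)]
    congr 1
    field_simp
    ring
  set cond : Option Bool × ℤ → Prop := fun s => s.1 = none with hcond
  have hdone : ∀ n b (m : ℤ), whileFuel cond (algBBody Q p β c) (n + 1) (some b, m)
      (fun _ _ => 1) = 1 := fun n b m => by
    rw [whileFuel_succ_of_neg (by simp [hcond])]
    rfl
  have key : ∀ (n j : ℕ), 1 ≤ whileFuel cond (algBBody Q p β c) (n + 1) (none, (j : ℤ) + 2)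
      (fun _ _ => 1) + D + r ^ n := by
    intro n
    induction n with
    | zero => simp
    | succ n ih =>
      intro j
      rw [whileFuel_succ_of_pos (by simp [hcond]), bind_apply,
        algBBody_apply h hQ fun s => whileFuel cond (algBBody Q p β c) (n + 1) s fun _ _ => 1,
        hdone, hdone, mul_one, mul_one]
      set a := whileFuel cond (algBBody Q p β c) (n + 1) (none, (j : ℤ) + 2 - 1) fun _ _ => 1
      have hmass := highPowerLogisticBF_mass h (m := (j : ℤ) + 2 - 2) (by omega)
      have hf := probOutput_highPowerLogisticBF_false_le h j
      have e : (j : ℤ) + 2 - 2 = j := by ring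
      rw [e] at hmass ⊢
      set u := probOutput (highPowerLogisticBF p j β c) true
      set v := probOutput (highPowerLogisticBF p j β c) false
      have hv : v ≤ v * (a + D + r ^ n) := by
        cases j with
        | zero =>
          have : v = 0 := by simpa using hf
          simp [this]
        | succ j =>
          have e2 : ((j + 1 : ℕ) : ℤ) + 2 - 1 = j + 2 := by push_cast; ring
          refine le_mul_of_one_le_right zero_le ?_
          have := ih j
          rwa [← e2] at this
      have hv1 : v ≤ 1 := probOutput_le_one (highPowerLogisticBF_isLaw h _) false
      set x := probOutput Q true
      set y := probOutput Q false
      calc 1 ≤ x + y + ENNReal.ofReal δ := hQm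
        _ = x * (u + v) + y + ENNReal.ofReal δ := by rw [hmass, mul_one]
        _ ≤ x * (u + v * (a + D + r ^ n)) + y + ENNReal.ofReal δ := by gcongr
        _ = x * (u + v * a) + y + (ENNReal.ofReal δ + x * v * D) + x * v * r ^ n := by ring
        _ ≤ x * (u + v * a) + y + (ENNReal.ofReal δ + r * 1 * D) + r * 1 * r ^ n := by gcongr
        _ = x * (u + v * a) + y + D + r ^ (n + 1) := by rw [mul_one, hDeq, pow_succ' r n]
  refine one_le_of_forall_one_le_add_pow (q := r) (ENNReal.ofReal_lt_one.2 h1) fun n => ?_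
  refine (key n j).trans ?_
  gcongr
  exact le_iSup (fun n => whileFuel cond (algBBody Q p β c) n (none, (j : ℤ) + 2) fun _ _ => 1)
    (n + 1)

end AlgB

/-! ### The numerical estimates -/

/-- The choice `M = ⌈4.5 / ε⌉`, `β = 1 + 1 / M` of `Linear_Bernoulli_Factory`, with
`ε' = 1 - (1 - ε) β` the parameter of the recursive calls.  Of the rounding only
`4.5 ≤ M ε ≤ 4.5 + ε` is recorded. -/
structure IsChoice (ε : ℝ) (M : ℕ) (β ε' : ℝ) : Prop where
  pos : 0 < ε
  le_one : ε ≤ 1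
  le_mul : 4.5 ≤ M * ε
  mul_le : M * ε ≤ 4.5 + ε
  beta_eq : β = 1 + 1 / M
  eps_eq : ε' = 1 - (1 - ε) * β

namespace IsChoice

variable {ε β ε' : ℝ} {M : ℕ}

theorem natCast_pos (h : IsChoice ε M β ε') : (0 : ℝ) < M := by
  by_contra hM
  nlinarith [h.pos, h.le_mul]

theorem one_lt_beta (h : IsChoice ε M β ε') : 1 < β := by
  have := h.natCast_pos
  rw [h.beta_eq]
  linarith [one_div_pos.2 this]

theorem mul_eps (h : IsChoice ε M β ε') : M * ε' = M * ε - (1 - ε) := by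
  have := h.natCast_pos
  rw [h.eps_eq, h.beta_eq]
  field_simp
  ring

theorem lower_bound_mul_eps (h : IsChoice ε M β ε') : 3.5 + ε ≤ M * ε' := by
  linarith [h.mul_eps, h.le_mul]

theorem eps_pos (h : IsChoice ε M β ε') : 0 < ε' := by
  have := h.lower_bound_mul_eps
  have := h.pos
  exact (pos_iff_pos_of_mul_pos (by linarith)).1 h.natCast_pos

theorem eps_le (h : IsChoice ε M β ε') : ε' ≤ ε := by
  refine le_of_mul_le_mul_left ?_ h.natCast_pos
  linarith [h.mul_eps, h.le_one]

theorem lower_bound_eps (h : IsChoice ε M β ε') : ε * (7 + 2 * ε) / 9 ≤ ε' := by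
  refine le_of_mul_le_mul_left ?_ h.natCast_pos
  rw [h.mul_eps]
  nlinarith [h.le_mul, h.le_one, h.pos]

end IsChoice

/-- An estimate for the cost factor of algorithm `A`: as `m (1 - ρ)` is at least `7 / 2`, the
quantity `m / (1 - ρ ^ m)` exceeds `m` by at most `4 / 11` of `1 / (1 - ρ)`. -/
theorem div_one_sub_pow_le {ρ : ℝ} (h0 : 0 ≤ ρ) (h1 : ρ < 1) {m : ℕ}
    (hm : 3.5 ≤ m * (1 - ρ)) :
    m / (1 - ρ ^ m) - 1 / (1 - ρ) ≤ m - 7 / 11 / (1 - ρ) := by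
  have hx : 0 < 1 - ρ := by linarith
  have hm0 : m ≠ 0 := by
    rintro rfl
    norm_num at hm
  have hpos := one_sub_pow_pos h0 h1 hm0
  set y : ℝ := m * (1 - ρ) with hy
  -- `ρ ^ m ≤ exp (-y)`, and `exp y ≥ 1 + y + y² / 2 ≥ 1 + 11 y / 4` for `y ≥ 7 / 2`.
  have hexp : ρ ^ m * (1 + y + y ^ 2 / 2) ≤ 1 := by
    have h2 : ρ ^ m ≤ Real.exp (-y) := by
      have : ρ ≤ Real.exp (-(1 - ρ)) := by linarith [Real.add_one_le_exp (-(1 - ρ))]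
      calc ρ ^ m ≤ Real.exp (-(1 - ρ)) ^ m := pow_le_pow_left₀ h0 this m
        _ = Real.exp (-y) := by rw [← Real.exp_nat_mul, hy]; ring_nf
    have h3 := Real.quadratic_le_exp_of_nonneg (x := y) (by linarith)
    calc _ ≤ Real.exp (-y) * Real.exp y := by gcongr
      _ = 1 := by rw [← Real.exp_add]; simp
  have hkey : ρ ^ m * (11 * y) ≤ 4 * (1 - ρ ^ m) := by
    have : 0 ≤ ρ ^ m := by positivity
    nlinarith [mul_nonneg this (mul_nonneg (by linarith : 0 ≤ y) (by linarith : 0 ≤ y - 3.5))]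
  have : m / (1 - ρ ^ m) ≤ m + 4 / 11 / (1 - ρ) := by
    rw [div_le_iff₀ hpos]
    have e : (m + 4 / 11 / (1 - ρ)) * (1 - ρ ^ m) - m
        = (4 * (1 - ρ ^ m) - ρ ^ m * (11 * y)) / (11 * (1 - ρ)) := by
      rw [hy]
      field_simp
      ring
    have : 0 ≤ (4 * (1 - ρ ^ m) - ρ ^ m * (11 * y)) / (11 * (1 - ρ)) :=
      div_nonneg (by linarith) (by linarith)
    linarith
  have e : 1 / (1 - ρ) = 4 / 11 / (1 - ρ) + 7 / 11 / (1 - ρ) := by ring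
  linarith

/-- The inequality behind the constant `7.57`, in terms of `z = 1 / (1 - ρ)`, `u = 1 / ε'` and
`t = 1 / M`.  The left side increases with `z`; at `z = u`, after multiplication by `ε`, it is
bounded by a quadratic polynomial in `ε`. -/
theorem flips_inequality_aux {ε M z u t : ℝ} (hε : 0 < ε) (hε1 : ε ≤ 1) (hz : 1 ≤ z) (hzu : z ≤ u)
    (hu : u * ε ≤ (9 - 2 * ε) / 7) (hu1 : 1 ≤ u * ε) (ht0 : 0 ≤ t) (ht : t ≤ 2 * ε / 9)
    (htu : 2 / 11 ≤ t * u) (hM : M * ε ≤ 4.5 + ε) :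
    M + 2 + t - 7 / 11 * z + (z - 1) * t * (7.57 * u + (z - 1)) ≤ 7.57 * ε⁻¹ := by
  have hA : M + 2 + t - 7 / 11 * z + (z - 1) * t * (7.57 * u + (z - 1))
      ≤ M + 2 + t - 7 / 11 * u + (u - 1) * t * (7.57 * u + (u - 1)) := by
    have h1 := mul_nonneg (sub_nonneg.2 hzu) (by linarith : 0 ≤ 7.57 * (t * u) - 7 / 11)
    have h2 := mul_nonneg ht0 (mul_nonneg (sub_nonneg.2 hzu) (by linarith : 0 ≤ u + z - 2))
    nlinarith
  refine hA.trans ?_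
  rw [← div_eq_mul_inv, le_div_iff₀ hε]
  set U := u * ε with hU
  have hB : t * ((u - 1) * (7.57 * u + (u - 1)) + 1)
      ≤ 2 * ε / 9 * ((u - 1) * (7.57 * u + (u - 1)) + 1) := by
    refine mul_le_mul_of_nonneg_right ht ?_
    have : 0 ≤ u - 1 := by linarith
    have : 0 ≤ u := by linarith
    positivity
  have hB' := mul_le_mul_of_nonneg_right hB hε.le
  have e : 2 * ε / 9 * ((u - 1) * (7.57 * u + (u - 1)) + 1) * ε
      = 2 / 9 * ((U - ε) * (7.57 * U + (U - ε)) + ε ^ 2) := by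
    rw [hU]
    ring
  rw [e] at hB'
  set V := (9 - 2 * ε) / 7 with hV
  have hC : (U - ε) * (7.57 * U + (U - ε)) ≤ (V - ε) * (7.57 * V + (V - ε)) := by
    have hVε : 0 ≤ V - ε := by linarith
    exact mul_le_mul (by linarith) (by linarith) (by nlinarith) hVε
  have hD : 4.5 + 3 * ε - 7 / 11 + 2 / 9 * ((V - ε) * (7.57 * V + (V - ε)) + ε ^ 2) ≤ 7.57 := by
    rw [hV]
    nlinarith [mul_nonneg hε.le (sub_nonneg.2 hε1)]
  nlinarith

theorem flips_inequality {ε β ε' ρ : ℝ} {M : ℕ} (h : IsChoice ε M β ε') (h0 : 0 ≤ ρ)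
    (h1 : ρ ≤ 1 - ε') :
    β * ((M + 1 : ℕ) / (1 - ρ ^ (M + 1)) - 1 / (1 - ρ))
      + ρ * ((1 - 1 / β) * ((7.57 * β * ε'⁻¹ + ρ * (β / (1 - ρ))) / (1 - ρ))) ≤ 7.57 * ε⁻¹ := by
  have hM := h.natCast_pos
  have he := h.eps_pos
  have hx : 0 < 1 - ρ := by linarith
  have hβ := h.one_lt_beta
  have hy : 3.5 ≤ ((M + 1 : ℕ) : ℝ) * (1 - ρ) := by
    push_cast
    have := h.lower_bound_mul_eps
    have : M * ε' ≤ M * (1 - ρ) := mul_le_mul_of_nonneg_left (by linarith) hM.le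
    linarith [h.pos]
  have hG := mul_le_mul_of_nonneg_left (div_one_sub_pow_le h0 (by linarith) hy)
    (by linarith : 0 ≤ β)
  have hz : 1 ≤ 1 / (1 - ρ) := by rw [le_div_iff₀ hx]; linarith
  have hzu : 1 / (1 - ρ) ≤ 1 / ε' := one_div_le_one_div_of_le he (by linarith)
  have hεp := h.pos
  have hε1 := h.le_one
  have hmain := flips_inequality_aux (ε := ε) (M := M) (z := 1 / (1 - ρ)) (u := 1 / ε')
    (t := 1 / M) hεp hε1 hz hzu
    (by
      have := h.lower_bound_eps
      rw [div_mul_eq_mul_div, div_le_div_iff₀ he (by norm_num)]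
      nlinarith [mul_nonneg hεp.le (sub_nonneg.2 hε1)])
    (by rw [div_mul_eq_mul_div, le_div_iff₀ he]; linarith [h.eps_le])
    (by positivity)
    (by rw [div_le_div_iff₀ hM (by norm_num)]; linarith [h.le_mul])
    (by
      rw [div_mul_div_comm, div_le_div_iff₀ (by norm_num) (by positivity)]
      linarith [h.mul_eps, h.mul_le])
    h.mul_le
  refine le_trans ?_ hmain
  have e1 : β * ((M + 1 : ℕ) - 7 / 11 / (1 - ρ))
      ≤ M + 2 + 1 / M - 7 / 11 * (1 / (1 - ρ)) := by
    have e : β * ((M + 1 : ℕ) : ℝ) = M + 2 + 1 / M := by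
      rw [h.beta_eq]
      push_cast
      field_simp
      ring
    have : 0 ≤ (β - 1) * (7 / 11 / (1 - ρ)) := mul_nonneg (by linarith) (by positivity)
    have e' : 7 / 11 * (1 / (1 - ρ)) = 7 / 11 / (1 - ρ) := by ring
    rw [e', mul_sub, e]
    linarith
  have e2 : ρ * ((1 - 1 / β) * ((7.57 * β * ε'⁻¹ + ρ * (β / (1 - ρ))) / (1 - ρ)))
      = (1 / (1 - ρ) - 1) * (1 / M) * (7.57 * (1 / ε') + (1 / (1 - ρ) - 1)) := by
    have e : (1 - 1 / β) * β = 1 / M := by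
      rw [h.beta_eq]
      field_simp
      ring
    have e' : 1 / (1 - ρ) - 1 = ρ / (1 - ρ) := by
      field_simp
      ring
    rw [← e, e']
    field_simp
  linarith

/-! ### The linear Bernoulli factory -/

section Linear

variable {k : ℕ} {p c : Fin k → ℝ} {ε β : ℝ} {N : ℕ}

/-- The parameters chosen by `Linear_Bernoulli_Factory`, with `m = N + 2`. -/
theorem exists_isChoice (hε : 0 < ε) (hε1 : ε ≤ 1) :
    ∃ N : ℕ, ⌈4.5 * ε⁻¹⌉ = ((N + 1 : ℕ) : ℤ) ∧
      IsChoice ε (N + 1) (1 + 1 / ((N + 1 : ℕ) : ℝ))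
        (1 - (1 - ε) * (1 + 1 / ((N + 1 : ℕ) : ℝ))) := by
  have hpos : 0 < 4.5 * ε⁻¹ := by positivity
  obtain ⟨N, hN⟩ : ∃ N : ℕ, ⌈4.5 * ε⁻¹⌉ = ((N + 1 : ℕ) : ℤ) :=
    ⟨(⌈4.5 * ε⁻¹⌉ - 1).toNat, by have := Int.ceil_pos.2 hpos; omega⟩
  have h1 := Int.le_ceil (4.5 * ε⁻¹)
  have h2 := (Int.ceil_lt_add_one (4.5 * ε⁻¹)).le
  rw [hN, Int.cast_natCast] at h1 h2
  refine ⟨N, hN, hε, hε1, ?_, ?_, rfl, rfl⟩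
  · rwa [← div_eq_mul_inv, div_le_iff₀ hε] at h1
  · have := mul_le_mul_of_nonneg_right h2 hε.le
    rwa [add_mul, mul_assoc, inv_mul_cancel₀ hε.ne', mul_one, one_mul] at this

theorem linearBFFuel_succ (p c : Fin k → ℝ) (n : ℕ) (hN : ⌈4.5 * ε⁻¹⌉ = ((N + 1 : ℕ) : ℤ))
    (hβ : β = 1 + 1 / ((N + 1 : ℕ) : ℝ)) :
    linearBFFuel p (n + 1) ε c = algA p ((N + 1 + 1 : ℕ) : ℤ) (fun i => β * c i) >>= fun B₁ =>
      if B₁ then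
        drawBern (1 / β) >>= fun B₂ =>
          if B₂ then pure true else algB (linearBFFuel p n) p ε ((N : ℤ) + 2) β c
      else pure false := by
  have e : (((N + 1 : ℕ) : ℤ) + 1 : ℤ) = (N : ℤ) + 2 := by push_cast; ring
  have e' : ((N + 1 + 1 : ℕ) : ℤ) = (N : ℤ) + 2 := by push_cast; ring
  have e2 : 1 + 1 / ((((N : ℤ) + 2 : ℤ) : ℝ) - 1) = β := by
    rw [hβ]
    push_cast
    ring_nf
  simp only [linearBFFuel, hN, e, e2, e']

/-- The mean of the linear factory: the correction by algorithm `B` removes exactly the bias of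
algorithm `A`. -/
theorem linear_mean {ρ : ℝ} (h0 : 0 ≤ ρ) (h1 : ρ < 1) (hβ : β = 1 + 1 / ((N + 1 : ℕ) : ℝ)) :
    (ρ - ρ ^ (N + 1 + 1)) / (1 - ρ ^ (N + 1 + 1))
      * (1 / β + (1 - 1 / β) * algBMean ρ N) = ρ / β := by
  have hp1 := (one_sub_pow_pos h0 h1 N.succ_ne_zero).ne'
  have hp2 := (one_sub_pow_pos h0 h1 (N + 1).succ_ne_zero).ne'
  simp only [Nat.succ_eq_add_one] at hp1 hp2
  have hN : (0 : ℝ) < N + 1 := by positivity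
  have hβ0 : β ≠ 0 := by rw [hβ]; positivity
  have e : (1 - 1 / β) = 1 / β / (N + 1) := by
    rw [hβ]
    push_cast
    field_simp
    ring
  rw [e]
  unfold algBMean
  field_simp
  ring

/-- What is proved about the linear factory by induction on the recursion depth `n`. -/
structure LinearBounds (p : Fin k → ℝ) (n : ℕ) (ε : ℝ) (c : Fin k → ℝ) : Prop where
  law : IsLaw (linearBFFuel p n ε c)
  prob_true_le : probOutput (linearBFFuel p n ε c) true ≤ ENNReal.ofReal (∑ i, c i * p i)
  prob_false_le : probOutput (linearBFFuel p n ε c) false ≤ ENNReal.ofReal (1 - ∑ i, c i * p i)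
  flips_le : expectedFlips (linearBFFuel p n ε c) ≤ ENNReal.ofReal (7.57 * (∑ i, c i) * ε⁻¹)
  one_le_mass_add : 1 ≤ probOutput (linearBFFuel p n ε c) true
    + probOutput (linearBFFuel p n ε c) false + ENNReal.ofReal ((2 / 7) ^ n)

theorem linearBounds (hp : ∀ i, p i ∈ Set.Icc (0 : ℝ) 1) (n : ℕ) (ε : ℝ) (c : Fin k → ℝ)
    (hc : ∀ i, 0 ≤ c i) (hC : 0 < ∑ i, c i) (hε : 0 < ε) (hr : ∑ i, c i * p i ≤ 1 - ε) :
    LinearBounds p n ε c := by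
  induction n generalizing ε c with
  | zero => exact ⟨IsLaw.diverge, zero_le, zero_le, zero_le, by simp⟩
  | succ n ih =>
    have hr0 := sum_mul_nonneg hp hc
    set r := ∑ i, c i * p i with hrdef
    set C := ∑ i, c i with hCdef
    obtain ⟨N, hN, hch⟩ := exists_isChoice hε (by linarith)
    set β : ℝ := 1 + 1 / ((N + 1 : ℕ) : ℝ) with hβ
    set ε' := 1 - (1 - ε) * β with hε'
    have hβ1 := hch.one_lt_beta
    have hβ0 : 0 < β := by linarith
    have he := hch.eps_pos
    have hsum : ∑ i, β * c i * p i = β * r := by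
      rw [hrdef, Finset.mul_sum]
      exact Finset.sum_congr rfl fun i _ => by ring
    have hsumC : ∑ i, β * c i = β * C := by rw [hCdef, Finset.mul_sum]
    set ρ := β * r with hρ
    have hρ0 : 0 ≤ ρ := by positivity
    have hρe : ρ ≤ 1 - ε' := by
      have := mul_le_mul_of_nonneg_left hr hβ0.le
      rw [hε', hρ]
      linarith
    have hρ1 : ρ < 1 := by linarith
    have hx : 0 < 1 - ρ := by linarith
    have hβc : ∀ i, 0 ≤ β * c i := fun i => mul_nonneg hβ0.le (hc i)
    have hβC : 0 < ∑ i, β * c i := by rw [hsumC]; positivity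
    have hlog : IsLogistic (logisticBF p fun i => β * c i) ρ (β * C) := by
      have := logisticBF_isLogistic hp hβc hβC (by rw [hsum]; exact hρ1)
      rwa [hsum, hsumC] at this
    have hQ := ih ε' (fun i => β * c i) hβc hβC he (by rw [hsum]; exact hρe)
    obtain ⟨hQ, hQt, hQf, hQF, hQm⟩ := hQ
    rw [hsum] at hQt hQf
    rw [hsumC] at hQF
    -- Algorithm `A` and algorithm `B`
    have hAlaw := algA_isLaw hlog ((N + 1 + 1 : ℕ) : ℤ)
    have hAt := probOutput_algA_true_le hlog (N + 1).succ_ne_zero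
    have hAf := probOutput_algA_false_le hlog (N + 1).succ_ne_zero
    have hAm := algA_mass hlog (N + 1).succ_ne_zero
    have hAF := expectedFlips_algA_le hlog (N + 1).succ_ne_zero
    have hBlaw := algB_isLaw hlog hQ ((N : ℤ) + 2)
    have hBt := probOutput_algB_true_le hlog hQ hQt hQf N
    have hBf := probOutput_algB_false_le hlog hQ hQt hQf N
    have hBF := expectedFlips_algB_le hlog hQ hQt hQf (by positivity) hQF N
    have hBm := one_le_algB_mass_add hlog hQ hQt (by positivity) hQm N
    have hq0 : 0 ≤ 1 / β := by positivity
    have hq1 : 1 / β ≤ 1 := (div_le_one hβ0).2 hβ1.le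
    have hq1' : 0 ≤ 1 - 1 / β := sub_nonneg.2 hq1
    simp only [Nat.succ_eq_add_one] at hAt hAf hAm hAF
    have hpos : 0 < 1 - ρ ^ (N + 1 + 1) := one_sub_pow_pos hρ0 hρ1 (N + 1).succ_ne_zero
    have hA0 : 0 ≤ (ρ - ρ ^ (N + 1 + 1)) / (1 - ρ ^ (N + 1 + 1)) :=
      div_nonneg (sub_nonneg.2 (pow_le_of_le_one hρ0 hρ1.le (by omega))) hpos.le
    have hA1 : (ρ - ρ ^ (N + 1 + 1)) / (1 - ρ ^ (N + 1 + 1)) ≤ ρ := by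
      rw [div_le_iff₀ hpos]
      nlinarith [mul_nonneg hx.le (pow_nonneg hρ0 (N + 1 + 1))]
    have hAf0 : 0 ≤ (1 - ρ) / (1 - ρ ^ (N + 1 + 1)) := div_nonneg hx.le hpos.le
    have hb0 := algBMean_nonneg hρ0 hρ1 N
    have hb1 := sub_nonneg.2 (algBMean_le_one hρ0 hρ1 N)
    have hmean := linear_mean hρ0 hρ1 (N := N) hβ
    have hρβ : ρ / β = r := by rw [hρ]; field_simp
    rw [hρβ] at hmean
    set S : Bool → Run Bool := fun B₂ =>
      if B₂ then pure true else algB (linearBFFuel p n) p ε ((N : ℤ) + 2) β c with hS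
    have hSlaw : ∀ b, IsLaw (S b) := fun b => IsLaw.ite (fun _ => IsLaw.pure _) fun _ => hBlaw
    have hDlaw := IsLaw.drawBern hq0 hq1
    set T : Bool → Run Bool := fun B₁ => if B₁ then drawBern (1 / β) >>= S else pure false with hT
    have hTlaw : ∀ b, IsLaw (T b) := fun b =>
      IsLaw.ite (fun _ => hDlaw.bind hSlaw) fun _ => IsLaw.pure _
    have hrun : linearBFFuel p (n + 1) ε c
        = algA p ((N + 1 + 1 : ℕ) : ℤ) (fun i => β * c i) >>= T :=
      linearBFFuel_succ p c n hN hβ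
    have hTt : ∀ b, probOutput (T true) b = ENNReal.ofReal (1 / β) * probOutput (S true) b
        + ENNReal.ofReal (1 - 1 / β) * probOutput (S false) b := fun b => by
      rw [hT]
      simp only [if_true]
      rw [probOutput_bind hDlaw, probOutput_drawBern, probOutput_drawBern]
      simp
    have hTf : ∀ b, probOutput (T false) b = if b then 0 else 1 := fun b => by
      cases b <;> simp [hT, probOutput_pure]
    have hSt : ∀ b, probOutput (S true) b = if b then 1 else 0 := fun b => by
      cases b <;> simp [hS, probOutput_pure]
    have hSf : S false = algB (linearBFFuel p n) p ε ((N : ℤ) + 2) β c := rfl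
    refine ⟨?_, ?_, ?_, ?_, ?_⟩
    · rw [hrun]
      exact hAlaw.bind hTlaw
    · rw [hrun, probOutput_bind hAlaw, hTf, hTt, hSt, hSf]
      simp only [if_true, mul_zero, add_zero]
      refine le_trans ?_ (ENNReal.ofReal_le_ofReal hmean.le)
      have hin := mul_add_mul_le_ofReal (le_refl (ENNReal.ofReal (1 / β)))
        (le_refl (ENNReal.ofReal (1 - 1 / β))) (ENNReal.ofReal_one.symm.le) hBt hq0 hq1'
        zero_le_one hb0
      rw [mul_one (1 / β)] at hin
      rw [ENNReal.ofReal_mul hA0]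
      gcongr
    · rw [hrun, probOutput_bind hAlaw, hTf, hTt, hSt, hSf]
      simp only [Bool.false_eq_true, if_false, mul_zero, zero_add]
      have hin := mul_le_mul' (le_refl (ENNReal.ofReal (1 - 1 / β))) hBf
      rw [← ENNReal.ofReal_mul hq1'] at hin
      refine (mul_add_mul_le_ofReal hAt hAf hin ENNReal.ofReal_one.symm.le hA0 hAf0
        (mul_nonneg hq1' hb1) zero_le_one).trans (ENNReal.ofReal_le_ofReal ?_)
      have e : (ρ - ρ ^ (N + 1 + 1)) / (1 - ρ ^ (N + 1 + 1))
          + (1 - ρ) / (1 - ρ ^ (N + 1 + 1)) = 1 := by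
        rw [← add_div, div_eq_one_iff_eq hpos.ne']
        simp
      apply le_of_eq
      linear_combination e - hmean
    · rw [hrun]
      refine (flips_bind_le hAlaw hTlaw).trans ?_
      have hTF : T true (fun _ n => (n : ℝ≥0∞)) ≤ ENNReal.ofReal ((1 - 1 / β)
          * ((7.57 * (β * C) * ε'⁻¹ + ρ * (β * C / (1 - ρ))) / (1 - ρ))) := by
        refine (flips_bind_le hDlaw hSlaw).trans ?_
        rw [expectedFlips_drawBern, zero_add, ENNReal.ofReal_mul hq1', probOutput_drawBern,
          probOutput_drawBern]
        have : S true (fun _ n => (n : ℝ≥0∞)) = 0 := by simp [hS, pure_apply]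
        rw [this, mul_zero, zero_add]
        exact mul_le_mul' le_rfl hBF
      have hTF' : T false (fun _ n => (n : ℝ≥0∞)) = 0 := by simp [hT, pure_apply]
      rw [hTF', mul_zero, add_zero]
      have hfin := mul_le_mul_of_nonneg_left (flips_inequality hch hρ0 hρe) hC.le
      refine (add_le_add hAF (mul_le_mul' (hAt.trans (ENNReal.ofReal_le_ofReal hA1)) hTF)).trans ?_
      have hG0 : 0 ≤ ((N + 1 + 1 : ℕ) : ℝ) / (1 - ρ ^ (N + 1 + 1)) - 1 / (1 - ρ) := by
        have := mul_one_sub_pow_le hρ0 hρ1.le (n := 1) (m := N + 1 + 1) (by omega)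
        rw [sub_nonneg, div_le_div_iff₀ hx hpos]
        simpa using this
      rw [← ENNReal.ofReal_mul hρ0, ← ENNReal.ofReal_add (by positivity) (by positivity)]
      apply ENNReal.ofReal_le_ofReal
      refine le_trans (le_of_eq ?_) (hfin.trans (le_of_eq ?_)) <;> ring
    · rw [hrun, probOutput_bind hAlaw, probOutput_bind hAlaw, hTf, hTf, hTt, hTt, hSt, hSt, hSf]
      simp only [if_true, Bool.false_eq_true, if_false, mul_zero, add_zero, zero_add, mul_one]
      set x := probOutput (algA p ((N + 1 + 1 : ℕ) : ℤ) fun i => β * c i) true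
      set y := probOutput (algA p ((N + 1 + 1 : ℕ) : ℤ) fun i => β * c i) false
      set u := probOutput (algB (linearBFFuel p n) p ε ((N : ℤ) + 2) β c) true
      set v := probOutput (algB (linearBFFuel p n) p ε ((N : ℤ) + 2) β c) false
      have hx1 : x ≤ 1 := probOutput_le_one hAlaw true
      have hq : ENNReal.ofReal (1 / β) + ENNReal.ofReal (1 - 1 / β) = 1 := by
        rw [← ENNReal.ofReal_add hq0 hq1']
        simp
      -- Algorithm `B` is called with probability at most `1 - 1 / β = 1 / m`, and
      -- `m (1 - ρ) ≥ 7 / 2`.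
      have hD : ENNReal.ofReal (1 - 1 / β) * ENNReal.ofReal ((2 / 7) ^ n / (1 - ρ))
          ≤ ENNReal.ofReal ((2 / 7) ^ (n + 1)) := by
        rw [← ENNReal.ofReal_mul hq1']
        apply ENNReal.ofReal_le_ofReal
        have h1 : 3.5 * (1 - 1 / β) ≤ 1 - ρ := by
          have h2 := hch.lower_bound_mul_eps
          have h3 : (1 - 1 / β) ≤ 1 / ((N + 1 : ℕ) : ℝ) := by
            have : 1 - 1 / β = (β - 1) / β := by field_simp
            rw [this, div_le_iff₀ hβ0]
            have h4 : β - 1 = 1 / ((N + 1 : ℕ) : ℝ) := by rw [hβ]; ring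
            rw [h4]
            exact le_mul_of_one_le_right (by positivity) hβ1.le
          have h5 : 3.5 * (1 / ((N + 1 : ℕ) : ℝ)) ≤ ε' := by
            rw [mul_one_div, div_le_iff₀ hch.natCast_pos]
            linarith
          linarith
        rw [pow_succ, mul_div_assoc', div_le_iff₀ hx]
        have : (0 : ℝ) ≤ (2 / 7) ^ n := by positivity
        nlinarith
      set a := ENNReal.ofReal (1 / β)
      set b := ENNReal.ofReal (1 - 1 / β)
      set D := ENNReal.ofReal ((2 / 7) ^ n / (1 - ρ))
      calc 1 = x * (a + b * 1) + y := by rw [mul_one, hq, mul_one, hAm]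
        _ ≤ x * (a + b * (u + v + D)) + y := by gcongr
        _ = x * (a + b * u) + (x * (b * v) + y) + x * (b * D) := by ring
        _ ≤ x * (a + b * u) + (x * (b * v) + y) + 1 * ENNReal.ofReal ((2 / 7) ^ (n + 1)) := by
          gcongr
        _ = _ := by rw [one_mul]

end Linear

end BernoulliFactory

theorem mainTheorem2 {k : ℕ} (p c : Fin k → ℝ) (ε : ℝ)
    (hp : ∀ i, p i ∈ Set.Icc (0 : ℝ) 1)
    (hc : ∀ i, 0 ≤ c i) (hC : 0 < ∑ i, c i)
    (hε : 0 < ε) (hr : ∑ i, c i * p i ≤ 1 - ε) :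
    BernoulliFactory.probOutput (BernoulliFactory.linearBF p ε c) true
        = ENNReal.ofReal (∑ i, c i * p i) ∧
      BernoulliFactory.probOutput (BernoulliFactory.linearBF p ε c) false
        = ENNReal.ofReal (1 - ∑ i, c i * p i) ∧
      BernoulliFactory.expectedFlips (BernoulliFactory.linearBF p ε c)
        ≤ ENNReal.ofReal (7.57 * (∑ i, c i) * ε⁻¹) := by
  have h := fun n => BernoulliFactory.linearBounds hp n ε c hc hC hε hr
  have hr0 := BernoulliFactory.sum_mul_nonneg hp hc
  have ht : BernoulliFactory.probOutput (BernoulliFactory.linearBF p ε c) true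
      ≤ ENNReal.ofReal (∑ i, c i * p i) := iSup_le fun n => (h n).prob_true_le
  have hf : BernoulliFactory.probOutput (BernoulliFactory.linearBF p ε c) false
      ≤ ENNReal.ofReal (1 - ∑ i, c i * p i) := iSup_le fun n => (h n).prob_false_le
  have hF : BernoulliFactory.expectedFlips (BernoulliFactory.linearBF p ε c)
      ≤ ENNReal.ofReal (7.57 * (∑ i, c i) * ε⁻¹) := iSup_le fun n => (h n).flips_le
  have hone : ENNReal.ofReal (∑ i, c i * p i) + ENNReal.ofReal (1 - ∑ i, c i * p i) = 1 := by
    rw [← ENNReal.ofReal_add hr0 (by linarith)]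
    simp
  have hmass : 1 ≤ BernoulliFactory.probOutput (BernoulliFactory.linearBF p ε c) true
      + BernoulliFactory.probOutput (BernoulliFactory.linearBF p ε c) false := by
    refine BernoulliFactory.one_le_of_forall_one_le_add_pow (q := ENNReal.ofReal (2 / 7))
      (ENNReal.ofReal_lt_one.2 (by norm_num)) fun n => (h n).one_le_mass_add.trans ?_
    rw [ENNReal.ofReal_pow (by norm_num)]
    gcongr
    · exact le_iSup (fun n => BernoulliFactory.linearBFFuel p n ε c
        fun a _ => if a = true then 1 else 0) n
    · exact le_iSup (fun n => BernoulliFactory.linearBFFuel p n ε c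
        fun a _ => if a = false then 1 else 0) n
  rw [← hone] at hmass
  -- Both probabilities attain their upper bounds, since the bounds add up to the total mass.
  refine ⟨le_antisymm ht ?_, le_antisymm hf ?_, hF⟩
  · exact (ENNReal.add_le_add_iff_right ENNReal.ofReal_ne_top).1
      (hmass.trans (add_le_add_right hf _))
  · exact (ENNReal.add_le_add_iff_left ENNReal.ofReal_ne_top).1
      (hmass.trans (add_le_add_left ht _))
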